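/- **Setting.** Graphs are simple undirected graphs $G=([n],E)$. The $k$-core of $G$ is its maximal subgraph in which every node has induced degree at least $k$; the core number $k(v)$ is the $\kappa$ such that $v$ lies in the $\kappa$-core but not in the $(\kappa+1)$-core. An estimate $\hat k(v)$ is $(\phi,\zeta)$-approximate if $k(v)-\zeta\le \hat k(v)\le \phi\,k(v)+\zeta$. Two graphs are edge-neighboring if their edge sets differ in exactly one edge; a randomized algorithm $M$ on graphs is $\varepsilon$-edge DP if $\Pr[M(G)\in S]\le e^{\varepsilon}\Pr[M(G')\in S]$ for all edge-neighboring $G,G'$ and all sets $S$. An $\varepsilon'$-local randomizer for node $v$ maps an adjacency list of $v$ to a random bit string, and its output probabilities change by a factor of at most $e^{\varepsilon'}$ if the list changes in one element. In a protocol, an untrusted curator maps the transcript so far (in each past round: the chosen nodes, their randomizers, the privacy parameters of these, the outputs) either to a new choice of nodes, local randomizers and privacy parameters, or to a halt; each chosen node applies its randomizer, with independent coins, to its own adjacency list. The protocol is $\varepsilon$-LEDP if its entire transcript is $\varepsilon$-edge DP. $\mathsf{Geom}(b)$ is the distribution on $\mathbb Z$ with mass $\frac{e^b-1}{e^b+1}e^{-|i|b}$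 at $i$. **The two protocols.** Fix parameters $\psi\in(0,1)$, $\lambda\in(-1,1)$, let $n\ge2$, $\varepsilon\in(0,1)$ and $\ell=\lceil\log_{1+\psi}n\rceil$. All samples $X$ are independent samples of $\mathsf{Geom}(\varepsilon/(8\ell^2))$. *Sequential version.* All nodes start at level $0$. In round $r=0,\dots,4\ell^2-2$ every node $i$ at level $r$ releases one bit, which is $1$ if and only if $U_i+X>(1+\psi)^{\lfloor r/(2\ell)\rfloor}$, where $U_i$ is the number of neighbors of $i$ at level $r$; if the bit is $1$, the node moves up to level $r+1$. At the end the curator outputs $\hat k(i)=(2+\lambda)(1+\psi)^{\max(\lfloor (L(i)+1)/(2\ell)\rfloor-1,\,0)}$, where $L(i)$ is the final level of $i$. *Parallel version.* For each group $g\in\{0,\dots,2\ell-1\}$ there is a separate copy with levels $0,\dots,2\ell-1$, and all nodes start at level $0$ in each of them. In round $r=0,\dots,2\ell-2$ every node $i$ releases $2\ell$ bits; the $g$-th bit is $1$ if and only if $i$ is at level $r$ in group $g$ and $U_{i,g}+X>(1+\psi)^g$, where $U_{i,g}$ is the number of neighbors of $i$ at level $r$ in group $g$; if the bit is $1$, the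 node moves up one level in group $g$. At the end $\hat k(i)=(2+\lambda)(1+\psi)^{g'}$, where $g'$ is the largest group in which $i$ is at level $2\ell-1$, or $0$ if there is none. **Theorem.** For every $\eta>0$ there are $\psi\in(0,1)$, $\lambda\in(-1,1)$ and $K>0$, depending only on $\eta$, and for every $c\ge1$ a constant $C>0$, depending only on $\eta$ and $c$, such that for all $n\ge2$ and all $\varepsilon\in(0,1)$: 1. The parallel version is an $\varepsilon$-LEDP protocol, always halts within $K\log n$ rounds and uses messages of at most $K\log n$ bits. For every graph $G$ on $[n]$, with probability at least $1-n^{-c}$ its outputs $\hat k(i)$ are $\left(2+\eta,\;C\,\frac{\log^3 n}{\varepsilon}\right)$-approximate core numbers for all nodes $i$ simultaneously. 2. The sequential version is an $\varepsilon$-LEDP protocol, always halts within $K\log^2 n$ rounds and uses messages of one bit. For every graph $G$ on $[n]$, with probability at least $1-n^{-c}$ its outputs $\hat k(i)$ are $\left(2+\eta,\;C\,\frac{\log^3 n}{\varepsilon}\right)$-approximate core numbers for all nodes $i$ simultaneously. In particular, there is an $O(\log n)$-round $\varepsilon$-LEDP algorithm that, for any constant $\eta>0$, returns $\left(2+\eta,O(\log^3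 n/\varepsilon)\right)$-approximate core numbers of all nodes with high probability. -/

import Mathlib

/-!  Core numbers, local edge differential privacy (protocols, transcripts, local randomizers), and
the two level-data-structure protocols for approximate core numbers. -/

namespace LEDP

open Classical in
/-- The adjacency list of `v`: its set of neighbours. -/
noncomputable def adjList {n : ℕ} (G : SimpleGraph (Fin n)) (v : Fin n) : Finset (Fin n) :=
  Finset.univ.filter (fun u => G.Adj v u)

/-! ### Core numbers -/

/-- Every node of `S` has at least `k` neighbours inside `S`. -/
def MinInducedDegree {n : ℕ} (G : SimpleGraph (Fin n)) (k : ℕ) (S : Finset (Fin n)) : Prop :=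
  ∀ u ∈ S, k ≤ (adjList G u ∩ S).card

open Classical in
/-- (The node set of) the `k`-core: the union of all `S` with minimum induced degree at least `k`,
which is the largest such set, see `kCore_greatest`. -/
noncomputable def kCore {n : ℕ} (G : SimpleGraph (Fin n)) (k : ℕ) : Finset (Fin n) :=
  Finset.univ.filter (fun v => ∃ S : Finset (Fin n), v ∈ S ∧ MinInducedDegree G k S)

theorem kCore_greatest {n : ℕ} (G : SimpleGraph (Fin n)) (k : ℕ) :
    IsGreatest {S : Finset (Fin n) | MinInducedDegree G k S} (kCore G k) := by
  have hsub : ∀ S : Finset (Fin n), MinInducedDegree G k S → S ⊆ kCore G k := by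
    intro S hS v hv
    simp only [kCore, Finset.mem_filter, Finset.mem_univ, true_and]
    exact ⟨S, hv, hS⟩
  refine ⟨?_, fun S hS => hsub S hS⟩
  intro u hu
  simp only [kCore, Finset.mem_filter, Finset.mem_univ, true_and] at hu
  obtain ⟨S, huS, hS⟩ := hu
  exact (hS u huS).trans (Finset.card_le_card (Finset.inter_subset_inter_left (hsub S hS)))

open Classical in
/-- The core number of `v`: the largest `k` such that `v` lies in the `k`-core. -/
noncomputable def coreNumber {n : ℕ} (G : SimpleGraph (Fin n)) (v : Fin n) : ℕ :=
  Nat.findGreatest (fun k => v ∈ kCore G k) n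

/-- `v` is part of the `κ`-core and not of the `(κ+1)`-core, for `κ = coreNumber G v`. -/
theorem coreNumber_spec {n : ℕ} (G : SimpleGraph (Fin n)) (v : Fin n) :
    v ∈ kCore G (coreNumber G v) ∧ v ∉ kCore G (coreNumber G v + 1) := by
  classical
  constructor
  · refine Nat.findGreatest_spec (P := fun k => v ∈ kCore G k) (Nat.zero_le n) ?_
    simp only [kCore, Finset.mem_filter, Finset.mem_univ, true_and]
    exact ⟨Finset.univ, Finset.mem_univ v, fun u _ => Nat.zero_le _⟩
  · intro h
    have hle : coreNumber G v + 1 ≤ n := by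
      have h1 := (kCore_greatest G (coreNumber G v + 1)).1 v h
      exact h1.trans ((Finset.card_le_univ _).trans (by simp))
    have := Nat.le_findGreatest (P := fun k => v ∈ kCore G k) hle h
    have h2 : coreNumber G v + 1 ≤ coreNumber G v := this
    omega

/-- `khat` is a `(φ, ζ)`-approximation of the core number `k`. -/
def IsApproxCoreNumber (φ ζ : ℝ) (k : ℕ) (khat : ℝ) : Prop :=
  (k : ℝ) - ζ ≤ khat ∧ khat ≤ φ * k + ζ

/-! ### Differential privacy -/

/-- Two graphs on the same nodes are edge-neighbouring if they differ in exactly one edge. -/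
def EdgeNeighboring {n : ℕ} (G G' : SimpleGraph (Fin n)) : Prop :=
  (symmDiff G.edgeSet G'.edgeSet).ncard = 1

/-- `ε`-edge differential privacy. The relation on the graphs is symmetric, so the one inequality
gives both bounds on the ratio of the two probabilities. -/
def EdgeDP {n : ℕ} {α : Type*} (ε : ℝ) (M : SimpleGraph (Fin n) → PMF α) : Prop :=
  ∀ G G' : SimpleGraph (Fin n), EdgeNeighboring G G' → ∀ S : Set α,
    (M G).toOuterMeasure S ≤ ENNReal.ofReal (Real.exp ε) * (M G').toOuterMeasure S

/-- A message is a bit string; its size is its length. -/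
abbrev Message : Type := List Bool

/-- A randomizer: a randomized map from adjacency lists to messages. -/
abbrev Randomizer (n : ℕ) : Type := Finset (Fin n) → PMF Message

/-- `R` is an `ε`-local randomizer for node `v`. -/
def IsLocalRandomizer {n : ℕ} (ε : ℝ) (v : Fin n) (R : Randomizer n) : Prop :=
  ∀ a a' : Finset (Fin n), v ∉ a → v ∉ a' → (symmDiff a a').card = 1 → ∀ Y : Set Message,
    (R a).toOuterMeasure Y ≤ ENNReal.ofReal (Real.exp ε) * (R a').toOuterMeasure Y

/-- What the curator announces in a round: the parties chosen, the randomizers assigned to them and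
their privacy parameters (the values at nodes that are not chosen are irrelevant). -/
structure Query (n : ℕ) where
  parties : Finset (Fin n)
  randomizer : Fin n → Randomizer n
  param : Fin n → NNReal

/-- The transcript of one round: the query and the outputs, `none` for nodes that are not chosen. -/
structure RoundRecord (n : ℕ) extends Query n where
  output : Fin n → Option Message

/-- A transcript lists the rounds so far, in order of time. -/
abbrev Transcript (n : ℕ) : Type := List (RoundRecord n)

/-- A protocol maps the transcript so far to the next query, or to `none` (halt). -/
abbrev Protocol (n : ℕ) : Type := Transcript n → Option (Query n)

/-- The product distribution: independent samples from `p 0, …, p (m - 1)`. -/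
noncomputable def indep {α : Type*} : (m : ℕ) → (Fin m → PMF α) → PMF (Fin m → α)
  | 0, _ => PMF.pure Fin.elim0
  | m + 1, p => (p 0).bind fun x =>
      (indep m (fun i => p i.succ)).map (fun f => (Fin.cons x f : Fin (m + 1) → α))

theorem indep_apply {α : Type*} : (m : ℕ) → (p : Fin m → PMF α) → (f : Fin m → α) →
    indep m p f = ∏ i, p i (f i)
  | 0, p, f => by
      have hf : f = Fin.elim0 := Subsingleton.elim _ _
      simp [indep, hf, PMF.pure_apply]
  | m + 1, p, f => by
      classical
      have key : ∀ x : α, (indep m (fun i => p i.succ)).map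
          (fun g => (Fin.cons x g : Fin (m + 1) → α)) f =
            if x = f 0 then ∏ i : Fin m, p i.succ (f i.succ) else 0 := by
        intro x
        rw [PMF.map_apply]
        by_cases hx : x = f 0
        · rw [if_pos hx, tsum_eq_single (Fin.tail f)]
          · rw [if_pos (by rw [hx, Fin.cons_self_tail]), indep_apply]
            rfl
          · intro g hg
            rw [if_neg]
            rintro h
            exact hg (by rw [h, Fin.tail_cons])
        · rw [if_neg hx, ENNReal.tsum_eq_zero]
          intro g
          rw [if_neg]
          rintro h
          exact hx (by rw [h, Fin.cons_zero])
      rw [indep, PMF.bind_apply, tsum_eq_single (f 0)]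
      · rw [key, if_pos rfl, Fin.prod_univ_succ]
      · intro x hx
        rw [key, if_neg hx, mul_zero]

/-- The outputs of one round: each chosen party runs its randomizer on its own adjacency list, with
independent coins. -/
noncomputable def Query.sample {n : ℕ} (q : Query n) (G : SimpleGraph (Fin n)) :
    PMF (Fin n → Option Message) :=
  indep n fun i =>
    if i ∈ q.parties then (q.randomizer i (adjList G i)).map some else PMF.pure none

/-- One step of the execution: halt, or run one more round and append it to the transcript. -/
noncomputable def Protocol.step {n : ℕ} (P : Protocol n) (G : SimpleGraph (Fin n))
    (π : Transcript n) : PMF (Transcript n) :=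
  match P π with
  | none => PMF.pure π
  | some q => (q.sample G).map fun o => π ++ [{ toQuery := q, output := o }]

/-- The distribution of the transcript after `t` rounds (or at the halt, if that comes earlier). -/
noncomputable def Protocol.run {n : ℕ} (P : Protocol n) (G : SimpleGraph (Fin n)) :
    ℕ → PMF (Transcript n)
  | 0 => PMF.pure []
  | t + 1 => (P.run G t).bind (P.step G)

/-- On every input and for all coins the protocol halts after at most `T` rounds. -/
def Protocol.HaltsWithin {n : ℕ} (P : Protocol n) (T : ℕ) : Prop :=
  ∀ G : SimpleGraph (Fin n), ∀ π ∈ (P.run G T).support, P π = none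

/-- On every input and for all coins every message sent by a node has at most `b` bits. -/
def Protocol.MessageBitsAtMost {n : ℕ} (P : Protocol n) (b : ℝ) : Prop :=
  ∀ G : SimpleGraph (Fin n), ∀ t : ℕ, ∀ π ∈ (P.run G t).support, ∀ ρ ∈ π, ∀ i : Fin n,
    ∀ m : Message, ρ.output i = some m → (m.length : ℝ) ≤ b

/-- `ε`-local edge differential privacy: each chosen party gets a local randomizer with the
announced privacy parameter, and the algorithm that outputs the entire transcript is
`ε`-edge differentially private. (For a protocol that halts within `T` rounds the transcript is the
one at any `t ≥ T`, and the transcripts at `t < T` are its prefixes.) -/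
def Protocol.IsLEDP {n : ℕ} (P : Protocol n) (ε : ℝ) : Prop :=
  (∀ π : Transcript n, ∀ q : Query n, P π = some q → ∀ i ∈ q.parties,
    IsLocalRandomizer (q.param i) i (q.randomizer i)) ∧
  ∀ t : ℕ, EdgeDP ε (fun G => P.run G t)

/-- A protocol that computes core estimates: the curator reads them off the final transcript. -/
structure CoreAlgorithm (n : ℕ) where
  protocol : Protocol n
  estimate : Transcript n → Fin n → ℝ

/-- `A` halts within `T` rounds, and on every graph the estimates that it returns are,
with probability at least `p`, `(φ, ζ)`-approximate core numbers for all nodes simultaneously. -/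
def CoreAlgorithm.Approximates {n : ℕ} (A : CoreAlgorithm n) (T : ℕ) (φ ζ p : ℝ) : Prop :=
  A.protocol.HaltsWithin T ∧ ∀ G : SimpleGraph (Fin n),
    ENNReal.ofReal p ≤ (A.protocol.run G T).toOuterMeasure
      {π | ∀ i, IsApproxCoreNumber φ ζ (coreNumber G i) (A.estimate π i)}

/-! ### The symmetric geometric distribution -/

/-- The mass of the symmetric geometric distribution at `i`. -/
noncomputable def symGeomMass (b : ℝ) (i : ℤ) : ℝ :=
  (Real.exp b - 1) / (Real.exp b + 1) * Real.exp (-((|i| : ℤ) : ℝ) * b)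

theorem symGeomMass_nonneg {b : ℝ} (hb : 0 < b) (i : ℤ) : 0 ≤ symGeomMass b i := by
  have h : 1 < Real.exp b := Real.one_lt_exp_iff.mpr hb
  unfold symGeomMass
  have := Real.exp_pos (-((|i| : ℤ) : ℝ) * b)
  have h2 : 0 ≤ (Real.exp b - 1) / (Real.exp b + 1) := div_nonneg (by linarith) (by linarith)
  positivity

theorem hasSum_symGeomMass {b : ℝ} (hb : 0 < b) : HasSum (symGeomMass b) 1 := by
  have h : 1 < Real.exp b := Real.one_lt_exp_iff.mpr hb
  set q := Real.exp (-b) with hq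
  have hqpos : 0 < q := Real.exp_pos _
  have hq1 : q < 1 := by rw [hq, Real.exp_lt_one_iff]; linarith
  have hqe : Real.exp b * q = 1 := by rw [hq, ← Real.exp_add]; simp
  have hpow : ∀ k : ℕ, Real.exp (-(k : ℝ) * b) = q ^ k := by
    intro k
    rw [hq, ← Real.exp_nat_mul]
    congr 1
    ring
  have hg := hasSum_geometric_of_lt_one hqpos.le hq1
  have h1 : HasSum (fun k : ℕ => symGeomMass b (k : ℤ))
      ((Real.exp b - 1) / (Real.exp b + 1) * (1 - q)⁻¹) := by
    refine (hg.mul_left ((Real.exp b - 1) / (Real.exp b + 1))).congr_fun ?_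
    intro k
    simp only [symGeomMass, Nat.abs_cast, Int.cast_natCast, hpow]
  have h2 : HasSum (fun k : ℕ => symGeomMass b (-((k : ℤ) + 1)))
      ((Real.exp b - 1) / (Real.exp b + 1) * (q * (1 - q)⁻¹)) := by
    refine ((hg.mul_left q).mul_left ((Real.exp b - 1) / (Real.exp b + 1))).congr_fun ?_
    intro k
    have habs : |(-((k : ℤ) + 1))| = ((k + 1 : ℕ) : ℤ) := by
      rw [abs_neg, abs_of_nonneg (by positivity)]
      simp
    simp only [symGeomMass, habs, Int.cast_natCast, hpow, pow_succ]
    ring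
  have h3 := HasSum.of_nat_of_neg_add_one h1 h2
  have hE : Real.exp b + 1 ≠ 0 := by linarith
  have hQ : 1 - q ≠ 0 := by linarith
  have hval : (Real.exp b - 1) / (Real.exp b + 1) * (1 - q)⁻¹ +
      (Real.exp b - 1) / (Real.exp b + 1) * (q * (1 - q)⁻¹) = 1 := by
    field_simp
    nlinarith [hqe]
  rwa [hval] at h3

/-- The symmetric geometric distribution with parameter `b > 0` (for `b ≤ 0`, where it does not
exist, the point mass at `0`; this case does not occur below). -/
noncomputable def symGeom (b : ℝ) : PMF ℤ :=
  if hb : 0 < b then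
    ⟨fun i => ENNReal.ofReal (symGeomMass b i), by
      have h := hasSum_symGeomMass hb
      have h2 := ENNReal.ofReal_tsum_of_nonneg (symGeomMass_nonneg hb) h.summable
      rw [h.tsum_eq, ENNReal.ofReal_one] at h2
      rw [h2]
      exact ENNReal.summable.hasSum⟩
  else PMF.pure 0

/-! ### The level data structure

Throughout, `logCeil ψ n = ⌈log_{1+ψ} n⌉` plays the role of `log n`. -/

noncomputable def logCeil (ψ : ℝ) (n : ℕ) : ℕ := ⌈Real.logb (1 + ψ) n⌉₊

open Classical in
/-- The bit computed by a node with adjacency list `a` that is at level `r`: the number of its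
neighbours at level `r` plus symmetric geometric noise is compared with `threshold`. -/
noncomputable def noisyBit {n : ℕ} (b threshold : ℝ) (L : Fin n → ℕ) (r : ℕ)
    (a : Finset (Fin n)) : PMF Bool :=
  (symGeom b).map fun X => decide (threshold < ((a.filter (fun j => L j = r)).card : ℝ) + (X : ℝ))

/-! #### One structure with `4 ℓ²` levels, in `2 ℓ` groups of `2 ℓ` consecutive levels -/

open Classical in
/-- The level of node `i`: all nodes start at level `0`, and `i` moves up one level whenever it
releases the bit `1`. -/
noncomputable def level {n : ℕ} (π : Transcript n) (i : Fin n) : ℕ :=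
  π.countP (fun ρ => decide (ρ.output i = some [true]))

/-- Round `r`, with `ℓ = logCeil ψ n`: each node `i` at level `r` releases one bit, which tells
whether its noisy number of neighbours at level `r` exceeds `(1 + ψ) ^ ⌊r / (2 ℓ)⌋`. The protocol
stops after the rounds `r = 0, …, 4 ℓ² - 2`. -/
noncomputable def sequentialProtocol (n : ℕ) (ψ ε : ℝ) : Protocol n := fun π =>
  let l := logCeil ψ n
  let r := π.length
  let b := ε / (8 * (l : ℝ) ^ 2)
  if r < 4 * l ^ 2 - 1 then
    some
      { parties := Finset.univ.filter (fun i => level π i = r)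
        randomizer := fun _ a =>
          (noisyBit b ((1 + ψ) ^ (r / (2 * l))) (level π) r a).map (fun x => [x])
        param := fun _ => b.toNNReal }
  else none

/-- The estimate is `(2 + lam) (1 + ψ) ^ g`, where `g` is the largest group index such that node `i`
ends at or above the topmost level of group `g`, or `0` if there is none (`-` on `ℕ` truncates
at `0`). -/
noncomputable def sequentialAlgorithm (n : ℕ) (ψ lam ε : ℝ) : CoreAlgorithm n where
  protocol := sequentialProtocol n ψ ε
  estimate := fun π i => (2 + lam) * (1 + ψ) ^ ((level π i + 1) / (2 * logCeil ψ n) - 1)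

/-! #### `2 ℓ` separate structures (groups) with `2 ℓ` levels each, processed simultaneously -/

open Classical in
/-- The level of node `i` in group `g`: it increases by one whenever `i` releases a bit string
whose bit number `g` is `1`. -/
noncomputable def groupLevel {n : ℕ} (π : Transcript n) (g : ℕ) (i : Fin n) : ℕ :=
  π.countP (fun ρ => decide (∃ m : Message, ρ.output i = some m ∧ m[g]? = some true))

/-- Round `r`, with `ℓ = logCeil ψ n`: every node `i` releases `2 ℓ` bits. Bit `g` is `0` unless `i`
is at level `r` in group `g`; then it tells whether the noisy number of neighbours of `i` at level
`r` in group `g` (with a fresh noise for each group) exceeds `(1 + ψ) ^ g`. The protocol stops after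
the rounds `r = 0, …, 2 ℓ - 2`. -/
noncomputable def parallelProtocol (n : ℕ) (ψ ε : ℝ) : Protocol n := fun π =>
  let l := logCeil ψ n
  let r := π.length
  let b := ε / (8 * (l : ℝ) ^ 2)
  if r < 2 * l - 1 then
    some
      { parties := Finset.univ
        randomizer := fun i a =>
          (indep (2 * l) fun g =>
            if groupLevel π g i = r then noisyBit b ((1 + ψ) ^ (g : ℕ)) (groupLevel π g) r a
            else PMF.pure false).map List.ofFn
        param := fun _ => (2 * (l : ℝ) * b).toNNReal }
  else none

open Classical in
/-- The estimate is `(2 + lam) (1 + ψ) ^ g`, where `g` is the largest group in which node `i` ends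
at the topmost level, or `0` if there is none. -/
noncomputable def parallelAlgorithm (n : ℕ) (ψ lam ε : ℝ) : CoreAlgorithm n where
  protocol := parallelProtocol n ψ ε
  estimate := fun π i =>
    let l := logCeil ψ n
    (2 + lam) * (1 + ψ) ^
      Nat.findGreatest (fun g => g < 2 * l ∧ groupLevel π g i = 2 * l - 1) (2 * l)

end LEDP

namespace LEDP

/-! ### Degrees outside a core and chains of node sets -/

/-! Utility. Call a move faithful if its noise has absolute value at most `B`. If all moves are
faithful, the sets of nodes still moving form a noisy peeling (`IsPeeling`). Two facts about
peelings suffice. A core survives as long as the thresholds plus `B` stay below its index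
(`IsPeeling.mem_of_coreNumber`). Conversely, the nodes of a set `W` outside the `(k+1)`-core have
average degree at most `2k` in `W`, by degeneracy (`sum_degree_sdiff_kCore_le`). So if the threshold
minus `B` is at least `2(1+ψ)k`, their number drops by a factor `1+ψ` per round, and none is left
after `ℓ` rounds (`IsPeeling.lt_coreNumber_of_mem`). Hence the last group `g` that a node completes
determines its core number up to a factor `2(1+ψ)²` and an error `2B`.

Probability. There are at most `4ℓ²n` noises, each exceeding `B` with probability at most
`2exp(-bB/2)`, where `b = ε/(8ℓ²)`. Taking `B` of order `ℓ² log n / ε`, that is `log³ n / ε`, makes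
the union bound polynomially small.

Privacy. An edge occurs in two adjacency lists and changes each count by at most one, so each noisy
bit costs `b`. Composition over at most `4ℓ²` bits at each of the two ends gives `8ℓ²b = ε`
(`Protocol.run_apply_le_mul`). -/

theorem mem_adjList {n : ℕ} {G : SimpleGraph (Fin n)} {u v : Fin n} :
    u ∈ adjList G v ↔ G.Adj v u := by
  simp [adjList]

/-- Outside the `(k+1)`-core, some node of `W` has at most `k` neighbours in `W`. -/
theorem exists_low_degree {n : ℕ} (G : SimpleGraph (Fin n)) (k : ℕ) (W : Finset (Fin n))
    (hW : (W \ kCore G (k + 1)).Nonempty) :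
    ∃ u ∈ W \ kCore G (k + 1), (adjList G u ∩ W).card ≤ k := by
  by_contra! hcon
  obtain ⟨hcore, hmax⟩ := kCore_greatest G (k + 1)
  -- If every such node had degree above `k`, adding `W` to the core would keep the minimum degree
  -- `k + 1`, against the maximality of the core.
  have hmin : MinInducedDegree G (k + 1) (W ∪ kCore G (k + 1)) := by
    intro u hu
    by_cases huc : u ∈ kCore G (k + 1)
    · exact (hcore u huc).trans
        (Finset.card_le_card (Finset.inter_subset_inter_left Finset.subset_union_right))
    · have huW : u ∈ W := (Finset.mem_union.1 hu).resolve_right huc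
      have := hcon u (Finset.mem_sdiff.2 ⟨huW, huc⟩)
      exact (Nat.succ_le_of_lt this).trans
        (Finset.card_le_card (Finset.inter_subset_inter_left Finset.subset_union_left))
  obtain ⟨u, hu⟩ := hW
  rw [Finset.mem_sdiff] at hu
  exact hu.2 (hmax hmin (Finset.mem_union_left _ hu.1))

/-- The nodes of `W` outside the `(k+1)`-core have average degree at most `2k` in `W`. -/
theorem sum_degree_sdiff_kCore_le {n : ℕ} (G : SimpleGraph (Fin n)) (k : ℕ) :
    ∀ W : Finset (Fin n), ∑ i ∈ W \ kCore G (k + 1), (adjList G i ∩ W).card ≤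
      2 * k * (W \ kCore G (k + 1)).card := by
  intro W
  induction W using Finset.strongInduction with
  | H W ih =>
    rcases (W \ kCore G (k + 1)).eq_empty_or_nonempty with he | hne
    · simp [he]
    -- Deleting `u` lowers the sum by at most `2k`: at most `k` for the term of `u`, and one for
    -- each neighbour of `u` in `A`, of which there are at most `k`.
    obtain ⟨u, hu, hdeg⟩ := exists_low_degree G k W hne
    have huW : u ∈ W := (Finset.mem_sdiff.1 hu).1
    have hih := ih (W.erase u) (Finset.erase_ssubset huW)
    rw [Finset.erase_sdiff_comm] at hih
    set A := W \ kCore G (k + 1) with hA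
    have hstep : ∀ i ∈ A.erase u, (adjList G i ∩ W).card ≤
        (adjList G i ∩ W.erase u).card + if i ∈ adjList G u then 1 else 0 := by
      intro i hi
      by_cases hiu : i ∈ adjList G u
      · rw [if_pos hiu, Finset.inter_erase]
        exact Nat.sub_le_iff_le_add.1 Finset.pred_card_le_card_erase
      · rw [if_neg hiu, add_zero]
        refine Finset.card_le_card fun j hj => ?_
        rw [Finset.mem_inter] at hj ⊢
        refine ⟨hj.1, Finset.mem_erase.2 ⟨?_, hj.2⟩⟩
        rintro rfl
        exact hiu (mem_adjList.2 (mem_adjList.1 hj.1).symm)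
    have hcount : (∑ i ∈ A.erase u, if i ∈ adjList G u then 1 else 0) ≤ k := by
      rw [← Finset.card_filter]
      refine (Finset.card_le_card fun j hj => ?_).trans hdeg
      rw [Finset.mem_filter, Finset.mem_erase, hA, Finset.mem_sdiff] at hj
      exact Finset.mem_inter.2 ⟨hj.2, hj.1.2.1⟩
    have hsum := Finset.sum_le_sum hstep
    rw [Finset.sum_add_distrib] at hsum
    rw [← Finset.add_sum_erase A _ hu, ← Finset.card_erase_add_one hu]
    have : 2 * k * ((A.erase u).card + 1) = 2 * k * (A.erase u).card + 2 * k := by ring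
    omega

/-- A sequence of node sets, where in round `r` the nodes with more than `τ r + B` neighbours in
the current set survive and those with at most `τ r - B` do not. -/
structure IsPeeling {n : ℕ} (G : SimpleGraph (Fin n)) (τ : ℕ → ℝ) (B : ℝ) (T : ℕ)
    (Z : ℕ → Finset (Fin n)) : Prop where
  zero : Z 0 = Finset.univ
  survive : ∀ r < T, ∀ i ∈ Z r, τ r + B < ((adjList G i ∩ Z r).card : ℝ) → i ∈ Z (r + 1)
  mem_of_succ : ∀ r < T, ∀ i ∈ Z (r + 1), i ∈ Z r
  degree_of_succ : ∀ r < T, ∀ i ∈ Z (r + 1), τ r - B < ((adjList G i ∩ Z r).card : ℝ)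

/-- The core containing `v` protects itself: while it lies inside the current set, each of its nodes
has enough neighbours there to pass the threshold. -/
theorem IsPeeling.mem_of_coreNumber {n : ℕ} {G : SimpleGraph (Fin n)} {τ : ℕ → ℝ} {B : ℝ} {T : ℕ}
    {Z : ℕ → Finset (Fin n)} (h : IsPeeling G τ B T Z) (v : Fin n) {r : ℕ} (hr : r ≤ T)
    (hτ : ∀ s < r, τ s + B < coreNumber G v) : v ∈ Z r := by
  have key : ∀ s ≤ r, kCore G (coreNumber G v) ⊆ Z s := by
    intro s
    induction s with
    | zero => intro _; rw [h.zero]; exact Finset.subset_univ _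
    | succ s ih =>
      intro hs i hi
      have hsub := ih (by omega)
      refine h.survive s (by omega) i (hsub hi) ((hτ s (by omega)).trans_le ?_)
      exact_mod_cast ((kCore_greatest G _).1 i hi).trans
        (Finset.card_le_card (Finset.inter_subset_inter_left hsub))
  exact key r le_rfl (coreNumber_spec G v).1

theorem IsPeeling.antitone {n : ℕ} {G : SimpleGraph (Fin n)} {τ : ℕ → ℝ} {B : ℝ} {T : ℕ}
    {Z : ℕ → Finset (Fin n)} (h : IsPeeling G τ B T Z) {r s : ℕ} (hrs : r ≤ s) (hs : s ≤ T) :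
    Z s ⊆ Z r := by
  induction s, hrs using Nat.le_induction with
  | base => exact subset_rfl
  | succ s _ ih => exact fun i hi => ih (by omega) (h.mem_of_succ s (by omega) i hi)

/-- Double counting: each survivor outside the core has more than `2qk` neighbours in `Z r`, while
the degrees there of all nodes of `Z r` outside the core sum to at most `2k` times their number. -/
theorem IsPeeling.card_sdiff_lt {n : ℕ} {G : SimpleGraph (Fin n)} {τ : ℕ → ℝ} {B : ℝ} {T : ℕ}
    {Z : ℕ → Finset (Fin n)} (h : IsPeeling G τ B T Z) {k r : ℕ} (hr : r < T) {q : ℝ}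
    (hτ : 2 * q * k ≤ τ r - B) (hne : (Z (r + 1) \ kCore G (k + 1)).Nonempty) :
    q * (Z (r + 1) \ kCore G (k + 1)).card < (Z r \ kCore G (k + 1)).card := by
  have h1 : ((Z (r + 1) \ kCore G (k + 1)).card : ℝ) * (2 * q * k) <
      ∑ i ∈ Z (r + 1) \ kCore G (k + 1), ((adjList G i ∩ Z r).card : ℝ) := by
    rw [← nsmul_eq_mul, ← Finset.sum_const]
    refine Finset.sum_lt_sum_of_nonempty hne fun i hi => ?_
    exact hτ.trans_lt (h.degree_of_succ r hr i (Finset.mem_sdiff.1 hi).1)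
  have h2 : ∑ i ∈ Z (r + 1) \ kCore G (k + 1), ((adjList G i ∩ Z r).card : ℝ) ≤
      ∑ i ∈ Z r \ kCore G (k + 1), ((adjList G i ∩ Z r).card : ℝ) :=
    Finset.sum_le_sum_of_subset_of_nonneg
      (Finset.sdiff_subset_sdiff (h.antitone (Nat.le_succ r) hr) subset_rfl)
      fun _ _ _ => Nat.cast_nonneg _
  have h3 : ∑ i ∈ Z r \ kCore G (k + 1), ((adjList G i ∩ Z r).card : ℝ) ≤
      2 * k * (Z r \ kCore G (k + 1)).card := by
    exact_mod_cast sum_degree_sdiff_kCore_le G k (Z r)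
  by_contra! hcon
  have hk : (0 : ℝ) ≤ 2 * k := by positivity
  nlinarith [mul_le_mul_of_nonneg_left hcon hk]

/-- A node that survives `m` rounds in a row has a large core number. -/
theorem IsPeeling.lt_coreNumber_of_mem {n : ℕ} {G : SimpleGraph (Fin n)} {τ : ℕ → ℝ} {B : ℝ}
    {T : ℕ} {Z : ℕ → Finset (Fin n)} (h : IsPeeling G τ B T Z) (v : Fin n) {r m : ℕ}
    (hr : r + (m + 1) ≤ T) {q t : ℝ} (hq : 0 < q) (hn : (n : ℝ) ≤ q ^ (m + 1))
    (hτ : ∀ j ≤ m, t ≤ τ (r + j)) (hv : v ∈ Z (r + (m + 1))) :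
    t - B < 2 * q * coreNumber G v := by
  by_contra! hcon
  set k := coreNumber G v
  have hvc : v ∉ kCore G (k + 1) := (coreNumber_spec G v).2
  have hlt : ∀ j ≤ m, q * (Z (r + (j + 1)) \ kCore G (k + 1)).card <
      (Z (r + j) \ kCore G (k + 1)).card := by
    intro j hj
    refine h.card_sdiff_lt (r := r + j) (by omega) (hcon.trans (by linarith [hτ j hj])) ?_
    exact ⟨v, Finset.mem_sdiff.2 ⟨h.antitone (by omega) hr hv, hvc⟩⟩
  have hle : ∀ j ≤ m, q ^ j * (Z (r + j) \ kCore G (k + 1)).card ≤ n := by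
    intro j
    induction j with
    | zero =>
      intro _
      rw [pow_zero, one_mul]
      exact_mod_cast (Finset.card_le_univ _).trans (by simp)
    | succ j ih =>
      intro hj
      calc q ^ (j + 1) * (Z (r + (j + 1)) \ kCore G (k + 1)).card
          = q ^ j * (q * (Z (r + (j + 1)) \ kCore G (k + 1)).card) := by ring
        _ ≤ q ^ j * (Z (r + j) \ kCore G (k + 1)).card :=
            mul_le_mul_of_nonneg_left (hlt j (by omega)).le (by positivity)
        _ ≤ n := ih (by omega)
  have h1 : (1 : ℝ) ≤ (Z (r + (m + 1)) \ kCore G (k + 1)).card := by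
    exact_mod_cast Finset.card_pos.2 ⟨v, Finset.mem_sdiff.2 ⟨hv, hvc⟩⟩
  -- Strictness in the last round alone is enough for `n ≤ q ^ (m + 1)` to give the contradiction.
  have h2 := mul_lt_mul_of_pos_left (hlt m le_rfl) (pow_pos hq m)
  have h3 := hle m le_rfl
  have h4 := mul_le_mul_of_nonneg_left h1 (pow_pos hq (m + 1)).le
  rw [pow_succ] at h4 hn
  linarith

/-! ### Peelings read off a transcript -/

open Classical in
/-- The number of rounds in which the output of node `i` satisfies `D`. -/
noncomputable def moveCount {n : ℕ} (D : Option Message → Prop) (π : Transcript n) (i : Fin n) :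
    ℕ :=
  π.countP (fun ρ => decide (D (ρ.output i)))

open Classical in
/-- The nodes whose output satisfies `D` in every round. -/
noncomputable def movers {n : ℕ} (D : Option Message → Prop) (π : Transcript n) :
    Finset (Fin n) :=
  Finset.univ.filter fun i => moveCount D π i = π.length

/-- Node `i` moves in the round after `π`, as told by `moved`, only if it moved in each round
before, and compares its number of neighbours with `t` up to an error of `B`. -/
def FaithfulMove {n : ℕ} (G : SimpleGraph (Fin n)) (D : Option Message → Prop) (t B : ℝ)
    (π : Transcript n) (i : Fin n) (moved : Prop) : Prop :=
  (moved → i ∈ movers D π ∧ t - B < ((adjList G i ∩ movers D π).card : ℝ)) ∧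
    (i ∈ movers D π → t + B < ((adjList G i ∩ movers D π).card : ℝ) → moved)

theorem moveCount_take_succ {n : ℕ} (D : Option Message → Prop) [DecidablePred D]
    (π : Transcript n) (i : Fin n) {k : ℕ} (hk : k < π.length) :
    moveCount D (π.take (k + 1)) i =
      moveCount D (π.take k) i + if D (π[k].output i) then 1 else 0 := by
  rw [moveCount, List.take_succ_eq_append_getElem hk, List.countP_append, moveCount]
  by_cases h : D (π[k].output i) <;> simp [h]

theorem moveCount_le_length {n : ℕ} (D : Option Message → Prop) (π : Transcript n) (i : Fin n) :
    moveCount D π i ≤ π.length :=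
  List.countP_le_length

theorem mem_movers {n : ℕ} {D : Option Message → Prop} {π : Transcript n} {i : Fin n} :
    i ∈ movers D π ↔ moveCount D π i = π.length := by
  simp [movers]

theorem mem_movers_take {n : ℕ} {D : Option Message → Prop} {π : Transcript n} {i : Fin n} {k : ℕ}
    (hk : k ≤ π.length) : i ∈ movers D (π.take k) ↔ moveCount D (π.take k) i = k := by
  rw [mem_movers, List.length_take, min_eq_left hk]

theorem mem_movers_take_succ {n : ℕ} {D : Option Message → Prop} {π : Transcript n} {i : Fin n}
    {k : ℕ} (hk : k < π.length) :
    i ∈ movers D (π.take (k + 1)) ↔ i ∈ movers D (π.take k) ∧ D (π[k].output i) := by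
  classical
  rw [mem_movers_take (Nat.succ_le_of_lt hk), mem_movers_take hk.le, moveCount_take_succ D π i hk]
  have := moveCount_le_length D (π.take k) i
  rw [List.length_take, min_eq_left hk.le] at this
  split_ifs with h <;> simp only [h, and_true, and_false, iff_false] <;> omega

/-- The bridge from randomness to combinatorics: once all moves are faithful, the noise plays no
further role. -/
theorem isPeeling_movers {n : ℕ} {G : SimpleGraph (Fin n)} {D : Option Message → Prop}
    {τ : ℕ → ℝ} {B : ℝ} {π : Transcript n}
    (h : ∀ k (hk : k < π.length), ∀ i,
      FaithfulMove G D (τ k) B (π.take k) i (D (π[k].output i))) :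
    IsPeeling G τ B π.length (fun r => movers D (π.take r)) where
  zero := by ext; simp [movers, moveCount]
  survive r hr i hi hd := (mem_movers_take_succ hr).2 ⟨hi, (h r hr i).2 hi hd⟩
  mem_of_succ r hr i hi := ((mem_movers_take_succ hr).1 hi).1
  degree_of_succ r hr i hi := ((h r hr i).1 ((mem_movers_take_succ hr).1 hi).2).2

/-- A node that is not at the current top level has stopped moving for good. -/
theorem mem_movers_iff_le_moveCount {n : ℕ} {G : SimpleGraph (Fin n)} {D : Option Message → Prop}
    {τ : ℕ → ℝ} {B : ℝ} {π : Transcript n}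
    (h : ∀ k (hk : k < π.length), ∀ i,
      FaithfulMove G D (τ k) B (π.take k) i (D (π[k].output i)))
    {i : Fin n} {r : ℕ} (hr : r ≤ π.length) :
    i ∈ movers D (π.take r) ↔ r ≤ moveCount D π i := by
  classical
  -- The moves of `i` occupy an initial block of rounds, because a faithful move requires a move in
  -- each earlier round.
  have key : ∀ s ≤ π.length, i ∈ movers D (π.take (moveCount D (π.take s) i)) := by
    intro s
    induction s with
    | zero => intro _; simp [movers, moveCount]
    | succ s ih =>
      intro hs
      rw [moveCount_take_succ D π i hs]
      split_ifs with hD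
      · have hm := ((h s hs i).1 hD).1
        rw [(mem_movers_take (Nat.le_of_succ_le hs)).1 hm]
        exact (mem_movers_take_succ hs).2 ⟨hm, hD⟩
      · exact ih (Nat.le_of_succ_le hs)
  constructor
  · intro hi
    rw [mem_movers_take hr] at hi
    calc r = moveCount D (π.take r) i := hi.symm
      _ ≤ moveCount D π i := (List.take_sublist r π).countP_le
  · intro hle
    have := key π.length le_rfl
    rw [List.take_length] at this
    exact (isPeeling_movers h).antitone hle (moveCount_le_length D π i) this

/-! ### Comparing probability mass functions pointwise -/

theorem toOuterMeasure_le_mul {α : Type*} {p q : PMF α} {c : ENNReal} (h : ∀ x, p x ≤ c * q x)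
    (S : Set α) : p.toOuterMeasure S ≤ c * q.toOuterMeasure S := by
  rw [PMF.toOuterMeasure_apply, PMF.toOuterMeasure_apply, ← ENNReal.tsum_mul_left]
  refine ENNReal.tsum_le_tsum fun x => ?_
  by_cases hx : x ∈ S <;> simp [hx, h x]

theorem map_apply_le_mul {α β : Type*} {p q : PMF α} {c : ENNReal} (h : ∀ x, p x ≤ c * q x)
    (f : α → β) (y : β) : p.map f y ≤ c * q.map f y := by
  rw [← PMF.toOuterMeasure_apply_singleton, ← PMF.toOuterMeasure_apply_singleton (q.map f),
    PMF.toOuterMeasure_map_apply, PMF.toOuterMeasure_map_apply]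
  exact toOuterMeasure_le_mul h _

theorem indep_apply_le_mul {α : Type*} {m : ℕ} {p q : Fin m → PMF α} {c : Fin m → ENNReal}
    (h : ∀ i x, p i x ≤ c i * q i x) (f : Fin m → α) :
    indep m p f ≤ (∏ i, c i) * indep m q f := by
  rw [indep_apply, indep_apply, ← Finset.prod_mul_distrib]
  exact Finset.prod_le_prod' fun i _ => h i (f i)

theorem le_mul_of_isLocalRandomizer {n : ℕ} {ε : ℝ} {v : Fin n} {R : Randomizer n}
    (h : IsLocalRandomizer ε v R) {a a' : Finset (Fin n)} (ha : v ∉ a) (ha' : v ∉ a')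
    (haa : (symmDiff a a').card = 1) (y : Message) :
    R a y ≤ ENNReal.ofReal (Real.exp ε) * R a' y := by
  rw [← PMF.toOuterMeasure_apply_singleton, ← PMF.toOuterMeasure_apply_singleton (R a')]
  exact h a a' ha ha' haa _

/-! ### Privacy of the transcript -/

theorem EdgeNeighboring.exists_adjList {n : ℕ} {G G' : SimpleGraph (Fin n)}
    (h : EdgeNeighboring G G') : ∃ u v : Fin n,
      (∀ w, w ≠ u → w ≠ v → adjList G w = adjList G' w) ∧
      ∀ w, (w = u ∨ w = v) → (symmDiff (adjList G w) (adjList G' w)).card = 1 := by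
  obtain ⟨e, he⟩ := Set.ncard_eq_one.1 h
  have key : ∀ x y, (G.Adj x y ∧ ¬ G'.Adj x y ∨ G'.Adj x y ∧ ¬ G.Adj x y) ↔ s(x, y) = e := by
    intro x y
    rw [← Set.mem_singleton_iff, ← he, Set.mem_symmDiff]
    simp only [SimpleGraph.mem_edgeSet]
  induction e using Sym2.ind with
  | _ u v =>
  have huv : u ≠ v := by
    rintro rfl
    have := (key u u).2 rfl
    simp at this
  refine ⟨u, v, fun w hu hv => ?_, fun w hw => ?_⟩
  · ext x
    have := key w x
    have hne : s(w, x) ≠ s(u, v) := by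
      rw [Ne, Sym2.eq_iff]
      tauto
    rw [mem_adjList, mem_adjList]
    tauto
  · rw [Finset.card_eq_one]
    rcases hw with rfl | rfl
    · refine ⟨v, ?_⟩
      ext x
      rw [Finset.mem_symmDiff, mem_adjList, mem_adjList, key, Finset.mem_singleton, Sym2.eq_iff]
      constructor
      · rintro (⟨_, h⟩ | ⟨h, _⟩)
        exacts [h, absurd h huv]
      · exact fun h => Or.inl ⟨rfl, h⟩
    · refine ⟨u, ?_⟩
      ext x
      rw [Finset.mem_symmDiff, mem_adjList, mem_adjList, key, Finset.mem_singleton, Sym2.eq_iff]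
      constructor
      · rintro (⟨h, _⟩ | ⟨_, h⟩)
        exacts [absurd h.symm huv, h]
      · exact fun h => Or.inr ⟨rfl, h⟩

/-- Independent coins make the probability of an outcome a product over the nodes. Only the factors
at the two ends of the changed edge differ, each by at most `exp p`. -/
theorem Query.sample_le_mul {n : ℕ} {q : Query n} {p : ℝ} (hp : 0 ≤ p)
    (hq : ∀ i ∈ q.parties, IsLocalRandomizer p i (q.randomizer i)) {G G' : SimpleGraph (Fin n)}
    (h : EdgeNeighboring G G') (o : Fin n → Option Message) :
    q.sample G o ≤ ENNReal.ofReal (Real.exp (2 * p)) * q.sample G' o := by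
  obtain ⟨u, v, hsame, hdiff⟩ := h.exists_adjList
  have hone : 1 ≤ ENNReal.ofReal (Real.exp p) := by
    rw [ENNReal.one_le_ofReal]
    exact Real.one_le_exp hp
  have hprod : ∏ i : Fin n, (if i ∈ ({u, v} : Finset (Fin n)) then ENNReal.ofReal (Real.exp p)
      else 1) ≤ ENNReal.ofReal (Real.exp (2 * p)) := by
    rw [Finset.prod_ite_mem, Finset.univ_inter, Finset.prod_const, two_mul, Real.exp_add,
      ENNReal.ofReal_mul (Real.exp_nonneg _), ← pow_two]
    exact pow_le_pow_right₀ hone Finset.card_le_two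
  refine le_trans (indep_apply_le_mul (c := fun i : Fin n => if i ∈ ({u, v} : Finset (Fin n))
    then ENNReal.ofReal (Real.exp p) else 1) (fun i x => ?_) o) (mul_le_mul_left hprod _)
  have hself : ∀ H : SimpleGraph (Fin n), i ∉ adjList H i := fun H => by simp [adjList]
  by_cases hi : i ∈ ({u, v} : Finset (Fin n))
  · rw [if_pos hi]
    rw [Finset.mem_insert, Finset.mem_singleton] at hi
    by_cases hpar : i ∈ q.parties
    · rw [if_pos hpar, if_pos hpar]
      exact map_apply_le_mul
        (le_mul_of_isLocalRandomizer (hq i hpar) (hself G) (hself G') (hdiff i hi)) _ _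
    · rw [if_neg hpar, if_neg hpar]
      exact le_mul_of_one_le_left zero_le hone
  · rw [if_neg hi, one_mul]
    rw [Finset.mem_insert, Finset.mem_singleton, not_or] at hi
    rw [hsame i hi.1 hi.2]

/-- A protocol whose queries consist of `p`-local randomizers spends `2 p` per round. -/
theorem Protocol.run_apply_le_mul {n : ℕ} {P : Protocol n} {p : ℝ} (hp : 0 ≤ p)
    (hP : ∀ π q, P π = some q → ∀ i ∈ q.parties, IsLocalRandomizer p i (q.randomizer i))
    {G G' : SimpleGraph (Fin n)} (h : EdgeNeighboring G G') (t : ℕ) (ρ : Transcript n) :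
    P.run G t ρ ≤ ENNReal.ofReal (Real.exp (2 * p)) ^ ρ.length * P.run G' t ρ := by
  induction t generalizing ρ with
  | zero =>
    rw [Protocol.run, Protocol.run, PMF.pure_apply]
    split_ifs with hρ <;> simp [hρ]
  | succ t ih =>
    rw [Protocol.run, Protocol.run, PMF.bind_apply, PMF.bind_apply, ← ENNReal.tsum_mul_left]
    refine ENNReal.tsum_le_tsum fun π => ?_
    by_cases hz : P.step G π ρ = 0
    · rw [hz, mul_zero]
      exact zero_le
    -- The query depends on `π` alone, so both graphs face the same one. The exponent is the
    -- transcript length and not `t`: a record is appended exactly when privacy is spent, and a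
    -- halted protocol spends nothing.
    have hstep : P.step G π ρ * ENNReal.ofReal (Real.exp (2 * p)) ^ π.length ≤
        ENNReal.ofReal (Real.exp (2 * p)) ^ ρ.length * P.step G' π ρ := by
      unfold Protocol.step at hz ⊢
      cases hq : P π with
      | none =>
        rw [hq] at hz
        simp only [PMF.pure_apply] at hz ⊢
        split_ifs at hz ⊢ with hρ
        · rw [hρ, mul_comm]
        · exact absurd rfl hz
      | some q =>
        rw [hq] at hz
        simp only at hz ⊢
        have hmem := (PMF.mem_support_iff _ _).2 hz
        rw [PMF.mem_support_map_iff] at hmem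
        obtain ⟨o, _, rfl⟩ := hmem
        rw [List.length_append, List.length_singleton, pow_succ, mul_assoc, mul_comm]
        exact mul_le_mul_right (map_apply_le_mul (q.sample_le_mul hp (hP π q hq) h) _ _) _
    calc P.run G t π * P.step G π ρ
        ≤ (ENNReal.ofReal (Real.exp (2 * p)) ^ π.length * P.run G' t π) * P.step G π ρ :=
          mul_le_mul_left (ih π) _
      _ = P.run G' t π * (P.step G π ρ * ENNReal.ofReal (Real.exp (2 * p)) ^ π.length) := by ring
      _ ≤ P.run G' t π * (ENNReal.ofReal (Real.exp (2 * p)) ^ ρ.length * P.step G' π ρ) :=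
          mul_le_mul_right hstep _
      _ = ENNReal.ofReal (Real.exp (2 * p)) ^ ρ.length * (P.run G' t π * P.step G' π ρ) := by ring

/-! ### Protocols that stop after a fixed number of rounds -/

theorem Protocol.length_of_mem_support {n : ℕ} {P : Protocol n} {T : ℕ}
    (hT : ∀ π, P π = none ↔ T ≤ π.length) (G : SimpleGraph (Fin n)) (t : ℕ) :
    ∀ π ∈ (P.run G t).support, π.length = min t T := by
  induction t with
  | zero => intro π hπ; simp_all [Protocol.run]
  | succ t ih =>
    intro ρ hρ
    rw [Protocol.run, PMF.mem_support_bind_iff] at hρ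
    obtain ⟨π, hπ, hρ⟩ := hρ
    have hlen := ih π hπ
    have hTπ := hT π
    unfold Protocol.step at hρ
    cases hq : P π with
    | none =>
      rw [hq] at hρ hTπ
      simp only [PMF.mem_support_pure_iff] at hρ
      have := hTπ.1 rfl
      rw [hρ]
      omega
    | some q =>
      rw [hq] at hρ hTπ
      simp only [PMF.mem_support_map_iff] at hρ
      obtain ⟨o, _, rfl⟩ := hρ
      have : ¬ T ≤ π.length := fun h => by simpa using hTπ.2 h
      rw [List.length_append, List.length_singleton]
      omega

theorem Protocol.haltsWithin_of_length {n : ℕ} {P : Protocol n} {T : ℕ}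
    (hT : ∀ π, P π = none ↔ T ≤ π.length) : P.HaltsWithin T := fun G π hπ =>
  (hT π).2 (by rw [P.length_of_mem_support hT G T π hπ, min_self])

theorem Protocol.edgeDP_run {n : ℕ} {P : Protocol n} {T : ℕ}
    (hT : ∀ π, P π = none ↔ T ≤ π.length) {p ε : ℝ} (hp : 0 ≤ p)
    (hP : ∀ π q, P π = some q → ∀ i ∈ q.parties, IsLocalRandomizer p i (q.randomizer i))
    (hε : T * (2 * p) ≤ ε) (t : ℕ) : EdgeDP ε (fun G => P.run G t) := by
  intro G G' h S
  refine toOuterMeasure_le_mul (fun π => ?_) S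
  -- The bound `T` on the length is available only for transcripts of positive probability; the
  -- others are trivial.
  by_cases hπ : π ∈ (P.run G t).support
  · refine (P.run_apply_le_mul hp hP h t π).trans (mul_le_mul_left ?_ _)
    rw [← ENNReal.ofReal_pow (Real.exp_nonneg _), ← Real.exp_nat_mul]
    refine ENNReal.ofReal_le_ofReal (Real.exp_le_exp.2 (le_trans ?_ hε))
    have hle : (π.length : ℝ) ≤ T := by
      exact_mod_cast (P.length_of_mem_support hT G t π hπ).trans_le (min_le_right _ _)
    exact mul_le_mul_of_nonneg_right hle (by linarith)
  · rw [(PMF.apply_eq_zero_iff _ _).2 hπ]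
    exact zero_le

/-! ### Union bounds -/

theorem indep_exists_le {α : Type*} : (m : ℕ) → (p : Fin m → PMF α) → (A : Fin m → Set α) →
    (indep m p).toOuterMeasure {f | ∃ i, f i ∈ A i} ≤ ∑ i, (p i).toOuterMeasure (A i)
  | 0, p, A => by
      simp
  | m + 1, p, A => by
      rw [indep, PMF.toOuterMeasure_bind_apply, Fin.sum_univ_succ]
      have hstep : ∀ x, (p 0) x * ((indep m fun i => p i.succ).map
          (fun f => (Fin.cons x f : Fin (m + 1) → α))).toOuterMeasure {f | ∃ i, f i ∈ A i} ≤
          (A 0).indicator (p 0) x +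
            p 0 x * ∑ i : Fin m, (p i.succ).toOuterMeasure (A i.succ) := by
        intro x
        by_cases hx : x ∈ A 0
        · rw [Set.indicator_of_mem hx]
          refine le_trans (mul_le_of_le_one_right' ?_) le_self_add
          exact le_trans (PMF.toOuterMeasure_mono _ (Set.subset_univ _))
            ((PMF.toOuterMeasure_apply_eq_one_iff _ _).2 (Set.subset_univ _)).le
        · rw [Set.indicator_of_notMem hx, zero_add, PMF.toOuterMeasure_map_apply]
          have : (fun f => (Fin.cons x f : Fin (m + 1) → α)) ⁻¹' {f | ∃ i, f i ∈ A i} =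
              {f | ∃ i : Fin m, f i ∈ A i.succ} := by
            ext f
            simp [Fin.exists_fin_succ, hx]
          rw [this]
          exact mul_le_mul_right (indep_exists_le m _ _) _
      refine (ENNReal.tsum_le_tsum hstep).trans ?_
      rw [ENNReal.tsum_add, ENNReal.tsum_mul_right, PMF.tsum_coe, one_mul,
        PMF.toOuterMeasure_apply]

/-- If in each round something goes wrong with probability at most `β`, then within `t` rounds
something goes wrong with probability at most `t β`. -/
theorem Protocol.run_exists_bad_le {n : ℕ} {P : Protocol n} {G : SimpleGraph (Fin n)}
    {β : ENNReal} {Bad : Transcript n → (Fin n → Option Message) → Prop}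
    (h : ∀ π q, P π = some q → (q.sample G).toOuterMeasure {o | Bad π o} ≤ β) (t : ℕ) :
    (P.run G t).toOuterMeasure
      {π | ∃ k, ∃ hk : k < π.length, Bad (π.take k) π[k].output} ≤ t * β := by
  induction t with
  | zero =>
    rw [Protocol.run, PMF.toOuterMeasure_pure_apply, if_neg (by simp)]
    exact zero_le
  | succ t ih =>
    set E : Set (Transcript n) := {π | ∃ k, ∃ hk : k < π.length, Bad (π.take k) π[k].output}
      with hE
    rw [Protocol.run, PMF.toOuterMeasure_bind_apply]
    -- A transcript that is already bad is charged to the induction hypothesis; a good one can turn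
    -- bad only in the new round, with conditional probability at most `β`.
    have hstep : ∀ π, P.run G t π * (P.step G π).toOuterMeasure E ≤
        E.indicator (P.run G t) π + P.run G t π * β := by
      intro π
      by_cases hπ : π ∈ E
      · rw [Set.indicator_of_mem hπ]
        refine le_trans (mul_le_of_le_one_right' ?_) le_self_add
        exact le_trans (PMF.toOuterMeasure_mono _ (Set.subset_univ _))
          ((PMF.toOuterMeasure_apply_eq_one_iff _ _).2 (Set.subset_univ _)).le
      · rw [Set.indicator_of_notMem hπ, zero_add]
        refine mul_le_mul_right ?_ _
        unfold Protocol.step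
        cases hq : P π with
        | none =>
          simp only [PMF.toOuterMeasure_pure_apply, if_neg hπ]
          exact zero_le
        | some q =>
          simp only [PMF.toOuterMeasure_map_apply]
          refine le_trans (PMF.toOuterMeasure_mono _ ?_) (h π q hq)
          rintro o ⟨⟨k, hk, hbad⟩, _⟩
          rw [List.length_append, List.length_singleton] at hk
          rcases Nat.lt_succ_iff_lt_or_eq.1 hk with hlt | rfl
          · refine absurd ⟨k, hlt, ?_⟩ hπ
            rw [List.take_append_of_le_length hlt.le] at hbad
            simpa [List.getElem_append_left hlt] using hbad
          · simpa using hbad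
    refine (ENNReal.tsum_le_tsum hstep).trans ?_
    rw [ENNReal.tsum_add, ENNReal.tsum_mul_right, PMF.tsum_coe, one_mul,
      ← PMF.toOuterMeasure_apply, Nat.cast_succ, add_mul, one_mul]
    exact add_le_add_left ih _

theorem one_sub_le_toOuterMeasure {α : Type*} (p : PMF α) {s t : Set α} {δ : ℝ}
    (hδ : 0 ≤ δ) (hs : p.toOuterMeasure s ≤ ENNReal.ofReal δ) (hst : ∀ x ∈ p.support, x ∉ s → x ∈ t) :
    ENNReal.ofReal (1 - δ) ≤ p.toOuterMeasure t := by
  have h1 : (1 : ENNReal) ≤ p.toOuterMeasure s + p.toOuterMeasure t := by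
    rw [← (PMF.toOuterMeasure_apply_eq_one_iff p (s ∪ t)).2 fun x hx => ?_]
    · exact MeasureTheory.measure_union_le s t
    · by_cases hxs : x ∈ s
      exacts [Or.inl hxs, Or.inr (hst x hx hxs)]
  rw [ENNReal.ofReal_sub _ hδ, ENNReal.ofReal_one, tsub_le_iff_left]
  exact h1.trans (add_le_add_left hs _)

/-! ### Symmetric geometric noise -/

theorem symGeom_apply {b : ℝ} (hb : 0 < b) (i : ℤ) :
    symGeom b i = ENNReal.ofReal (symGeomMass b i) := by
  have h : symGeom b = _ := dif_pos hb
  rw [h]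
  rfl

/-- The logarithm of the mass is `b`-Lipschitz, as `|i + d| ≤ |i| + 1`. -/
theorem symGeom_le_mul_shift {b : ℝ} (hb : 0 < b) (i : ℤ) {d : ℤ} (hd : |d| ≤ 1) :
    symGeom b i ≤ ENNReal.ofReal (Real.exp b) * symGeom b (i + d) := by
  rw [symGeom_apply hb, symGeom_apply hb, ← ENNReal.ofReal_mul (Real.exp_nonneg _)]
  refine ENNReal.ofReal_le_ofReal ?_
  unfold symGeomMass
  have h1 : 1 < Real.exp b := Real.one_lt_exp_iff.mpr hb
  have h2 : 0 ≤ (Real.exp b - 1) / (Real.exp b + 1) := div_nonneg (by linarith) (by linarith)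
  rw [mul_left_comm, ← Real.exp_add]
  refine mul_le_mul_of_nonneg_left (Real.exp_le_exp.2 ?_) h2
  have h3 : |i + d| ≤ |i| + 1 := (abs_add_le i d).trans (by omega)
  have h4 : ((|i + d| : ℤ) : ℝ) ≤ ((|i| : ℤ) : ℝ) + 1 := by exact_mod_cast h3
  nlinarith

/-- In place of summing a series, the mass beyond `B` is compared pointwise with that of the
distribution of parameter `b / 2`, whose total is one. The halved exponent costs only constants. -/
theorem symGeom_tail {b B : ℝ} (hb : 0 < b) :
    (symGeom b).toOuterMeasure {X : ℤ | B < |(X : ℝ)|} ≤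
      ENNReal.ofReal (2 * Real.exp (-(b / 2 * B))) := by
  have hb2 : 0 < b / 2 := by positivity
  have hpt : ∀ X : ℤ, B < |(X : ℝ)| → symGeom b X ≤
      ENNReal.ofReal (2 * Real.exp (-(b / 2 * B))) * symGeom (b / 2) X := by
    intro X hX
    rw [symGeom_apply hb, symGeom_apply hb2, ← ENNReal.ofReal_mul (by positivity)]
    refine ENNReal.ofReal_le_ofReal ?_
    unfold symGeomMass
    push_cast
    have hy : 1 < Real.exp (b / 2) := Real.one_lt_exp_iff.mpr hb2
    have hyy : Real.exp b = Real.exp (b / 2) ^ 2 := by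
      rw [← Real.exp_nat_mul]
      congr 1
      push_cast
      ring
    have hexp : Real.exp (-|(X : ℝ)| * b) ≤
        Real.exp (-(b / 2 * B)) * Real.exp (-|(X : ℝ)| * (b / 2)) := by
      rw [← Real.exp_add]
      refine Real.exp_le_exp.2 ?_
      nlinarith
    -- With `y = exp (b / 2)` this reduces to `(y - 1) ^ 3 ≥ 0`.
    have hconst : (Real.exp b - 1) / (Real.exp b + 1) ≤
        2 * ((Real.exp (b / 2) - 1) / (Real.exp (b / 2) + 1)) := by
      rw [hyy]
      generalize Real.exp (b / 2) = y at hy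
      rw [← mul_div_assoc, div_le_div_iff₀ (by positivity) (by linarith)]
      have : 0 ≤ (y - 1) * (y - 1) ^ 2 := mul_nonneg (by linarith) (sq_nonneg _)
      nlinarith
    calc (Real.exp b - 1) / (Real.exp b + 1) * Real.exp (-|(X : ℝ)| * b)
        ≤ 2 * ((Real.exp (b / 2) - 1) / (Real.exp (b / 2) + 1)) *
          (Real.exp (-(b / 2 * B)) * Real.exp (-|(X : ℝ)| * (b / 2))) := by
          refine mul_le_mul hconst hexp (Real.exp_nonneg _) ?_
          exact mul_nonneg zero_le_two (div_nonneg (by linarith) (by linarith))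
      _ = _ := by ring
  rw [PMF.toOuterMeasure_apply]
  calc ∑' X, ({X : ℤ | B < |(X : ℝ)|}).indicator (symGeom b) X
      ≤ ∑' X, ENNReal.ofReal (2 * Real.exp (-(b / 2 * B))) * symGeom (b / 2) X := by
        refine ENNReal.tsum_le_tsum fun X => ?_
        by_cases hX : B < |(X : ℝ)|
        · rw [Set.indicator_of_mem (by exact hX)]
          exact hpt X hX
        · rw [Set.indicator_of_notMem (by exact hX)]
          exact zero_le
    _ = ENNReal.ofReal (2 * Real.exp (-(b / 2 * B))) := by
        rw [ENNReal.tsum_mul_left, PMF.tsum_coe, mul_one]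

theorem card_filter_le_of_symmDiff {α : Type*} [DecidableEq α] {a a' : Finset α}
    (h : (symmDiff a a').card = 1) (p : α → Prop) [DecidablePred p] :
    (a.filter p).card ≤ (a'.filter p).card + 1 := by
  rw [← h]
  refine (Finset.card_le_card fun x hx => ?_).trans (Finset.card_union_le _ _)
  rw [Finset.mem_filter] at hx
  rw [Finset.mem_union, Finset.mem_filter, Finset.mem_symmDiff]
  tauto

/-- Brings the noise back to `ℤ`, where it can be shifted; the definition unfolds to a real-valued
noise. -/
theorem noisyBit_eq_map {n : ℕ} (b t : ℝ) (L : Fin n → ℕ) (r : ℕ) (a : Finset (Fin n)) :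
    noisyBit b t L r a = (symGeom b).map fun X : ℤ =>
      decide (t < ((a.filter (fun j => L j = r)).card : ℝ) + (X : ℝ)) := by
  have h : noisyBit b t L r a = ((symGeom b).map fun X : ℤ => (X : ℝ)).map fun X : ℝ =>
      decide (t < ((a.filter (fun j => L j = r)).card : ℝ) + X) := rfl
  rw [h, PMF.map_comp]
  rfl

/-- Shift coupling: noise `X` at degree `u` gives the same bit as noise `X + (u - u')` at degree
`u'`, and the two degrees differ by at most one. -/
theorem noisyBit_le_mul {n : ℕ} {b : ℝ} (hb : 0 < b) (t : ℝ) (L : Fin n → ℕ) (r : ℕ)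
    {a a' : Finset (Fin n)} (h : (symmDiff a a').card = 1) (x : Bool) :
    noisyBit b t L r a x ≤ ENNReal.ofReal (Real.exp b) * noisyBit b t L r a' x := by
  have h1 := card_filter_le_of_symmDiff h (fun j => L j = r)
  have h2 := card_filter_le_of_symmDiff (symmDiff_comm a a' ▸ h) (fun j => L j = r)
  rw [noisyBit_eq_map, noisyBit_eq_map]
  set u := (a.filter (fun j => L j = r)).card
  set u' := (a'.filter (fun j => L j = r)).card
  have hd : |(u : ℤ) - u'| ≤ 1 := by rw [abs_le]; omega
  rw [PMF.map_apply, PMF.map_apply]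
  refine le_of_le_of_eq ?_ (congrArg _ ((Equiv.addRight ((u : ℤ) - u')).tsum_eq _))
  rw [← ENNReal.tsum_mul_left]
  refine ENNReal.tsum_le_tsum fun X => ?_
  have hX : (u' : ℝ) + ((Equiv.addRight ((u : ℤ) - u') X : ℤ) : ℝ) = u + X := by
    rw [Equiv.coe_addRight]
    push_cast
    ring
  rw [hX]
  split_ifs
  · exact symGeom_le_mul_shift hb X hd
  · exact zero_le

/-- The noisy bit is faithful up to an error of `B` unless the noise exceeds `B`. -/
theorem noisyBit_not_faithfulMove_le {n : ℕ} {b B : ℝ} (hb : 0 < b) {G : SimpleGraph (Fin n)}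
    {D : Option Message → Prop} {t : ℝ} {π : Transcript n} {i : Fin n}
    (hi : moveCount D π i = π.length) :
    (noisyBit b t (moveCount D π) π.length (adjList G i)).toOuterMeasure
      {x | ¬ FaithfulMove G D t B π i (x = true)} ≤
        ENNReal.ofReal (2 * Real.exp (-(b / 2 * B))) := by
  rw [noisyBit_eq_map, PMF.toOuterMeasure_map_apply]
  refine le_trans (PMF.toOuterMeasure_mono _ ?_) (symGeom_tail hb)
  rintro X ⟨hX, _⟩
  by_contra hXB
  refine hX ?_
  rw [Set.mem_ofPred_eq, not_lt, abs_le] at hXB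
  have hdeg : (adjList G i).filter (fun j => moveCount D π j = π.length) =
      adjList G i ∩ movers D π := by
    ext j
    rw [Finset.mem_filter, Finset.mem_inter, mem_movers]
  rw [hdeg]
  simp only [FaithfulMove, decide_eq_true_eq]
  exact ⟨fun h => ⟨mem_movers.2 hi, by linarith⟩, fun _ h => by linarith⟩

/-- A node that has dropped out stays put with certainty, which is always faithful. -/
theorem pure_not_faithfulMove_le {n : ℕ} {α : Type*} {B : ℝ} {G : SimpleGraph (Fin n)}
    {D : Option Message → Prop} {t : ℝ} {π : Transcript n} {i : Fin n}
    (hi : moveCount D π i ≠ π.length) {moved : α → Prop} {y : α} (hy : ¬ moved y) (δ : ENNReal) :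
    (PMF.pure y).toOuterMeasure {x | ¬ FaithfulMove G D t B π i (moved x)} ≤ δ := by
  rw [PMF.toOuterMeasure_pure_apply, if_neg]
  · exact zero_le
  · rw [Set.mem_ofPred_eq, not_not]
    exact ⟨fun h => absurd h hy, fun h => absurd (mem_movers.1 h) hi⟩

/-! ### The sequential protocol -/

theorem level_eq_moveCount {n : ℕ} (π : Transcript n) :
    level π = moveCount (· = some [true]) π := by
  funext i
  unfold level moveCount
  congr!

theorem sequentialProtocol_eq_none_iff (n : ℕ) (ψ ε : ℝ) (π : Transcript n) :
    sequentialProtocol n ψ ε π = none ↔ 4 * logCeil ψ n ^ 2 - 1 ≤ π.length := by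
  simp [sequentialProtocol]

theorem sequentialProtocol_isLocalRandomizer {n : ℕ} {ψ ε : ℝ}
    (hb : 0 < ε / (8 * (logCeil ψ n : ℝ) ^ 2)) {π : Transcript n} {q : Query n}
    (hq : sequentialProtocol n ψ ε π = some q) (i : Fin n) :
    ((q.param i : NNReal) : ℝ) = ε / (8 * (logCeil ψ n : ℝ) ^ 2) ∧
      IsLocalRandomizer (ε / (8 * (logCeil ψ n : ℝ) ^ 2)) i (q.randomizer i) := by
  unfold sequentialProtocol at hq
  simp only [Option.ite_none_right_eq_some, Option.some.injEq] at hq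
  obtain ⟨_, rfl⟩ := hq
  refine ⟨Real.coe_toNNReal _ hb.le, fun a a' _ _ h Y => toOuterMeasure_le_mul (fun y => ?_) Y⟩
  exact map_apply_le_mul (noisyBit_le_mul hb _ _ _ h) _ _

theorem sequentialProtocol_sample_le {n : ℕ} {ψ ε B : ℝ}
    (hb : 0 < ε / (8 * (logCeil ψ n : ℝ) ^ 2)) {π : Transcript n} {q : Query n}
    (hq : sequentialProtocol n ψ ε π = some q) (G : SimpleGraph (Fin n)) :
    (q.sample G).toOuterMeasure {o | ∃ i, ¬ FaithfulMove G (· = some [true])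
      ((1 + ψ) ^ (π.length / (2 * logCeil ψ n))) B π i (o i = some [true])} ≤
        n * ENNReal.ofReal (2 * Real.exp (-(ε / (8 * (logCeil ψ n : ℝ) ^ 2) / 2 * B))) := by
  unfold sequentialProtocol at hq
  simp only [Option.ite_none_right_eq_some, Option.some.injEq] at hq
  obtain ⟨_, rfl⟩ := hq
  refine (indep_exists_le n _ fun i => {m | ¬ FaithfulMove G (· = some [true])
      ((1 + ψ) ^ (π.length / (2 * logCeil ψ n))) B π i (m = some [true])}).trans ?_
  refine (Finset.sum_le_card_nsmul _ _ _ fun i _ => ?_).trans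
    (by rw [Finset.card_univ, Fintype.card_fin, nsmul_eq_mul])
  simp only [Finset.mem_filter, Finset.mem_univ, true_and, level_eq_moveCount]
  split_ifs with hi
  · rw [PMF.toOuterMeasure_map_apply, PMF.toOuterMeasure_map_apply]
    simpa using noisyBit_not_faithfulMove_le (G := G) (B := B) hb hi
  · exact pure_not_faithfulMove_le (moved := (· = some [true])) hi (by simp) _

/-! ### The parallel protocol -/

theorem groupLevel_eq_moveCount {n : ℕ} (π : Transcript n) (g : ℕ) :
    groupLevel π g = moveCount (fun m => ∃ s : Message, m = some s ∧ s[g]? = some true) π := by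
  funext i
  unfold groupLevel moveCount
  congr!

theorem parallelProtocol_eq_none_iff (n : ℕ) (ψ ε : ℝ) (π : Transcript n) :
    parallelProtocol n ψ ε π = none ↔ 2 * logCeil ψ n - 1 ≤ π.length := by
  simp [parallelProtocol]

/-- The `2ℓ` bits read the same adjacency list with independent noises, so their costs add up; the
constant bits are bounded by the same factor. -/
theorem parallelProtocol_isLocalRandomizer {n : ℕ} {ψ ε : ℝ}
    (hb : 0 < ε / (8 * (logCeil ψ n : ℝ) ^ 2)) {π : Transcript n} {q : Query n}
    (hq : parallelProtocol n ψ ε π = some q) (i : Fin n) :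
    ((q.param i : NNReal) : ℝ) = 2 * logCeil ψ n * (ε / (8 * (logCeil ψ n : ℝ) ^ 2)) ∧
      IsLocalRandomizer (2 * logCeil ψ n * (ε / (8 * (logCeil ψ n : ℝ) ^ 2))) i
        (q.randomizer i) := by
  unfold parallelProtocol at hq
  simp only [Option.ite_none_right_eq_some, Option.some.injEq] at hq
  obtain ⟨_, rfl⟩ := hq
  refine ⟨Real.coe_toNNReal _ (by positivity),
    fun a a' _ _ h Y => toOuterMeasure_le_mul (fun y => ?_) Y⟩
  have hexp : ENNReal.ofReal
      (Real.exp (2 * logCeil ψ n * (ε / (8 * (logCeil ψ n : ℝ) ^ 2)))) =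
      ∏ _g : Fin (2 * logCeil ψ n),
        ENNReal.ofReal (Real.exp (ε / (8 * (logCeil ψ n : ℝ) ^ 2))) := by
    rw [Finset.prod_const, Finset.card_univ, Fintype.card_fin,
      ← ENNReal.ofReal_pow (Real.exp_nonneg _), ← Real.exp_nat_mul]
    push_cast
    rfl
  rw [hexp]
  refine map_apply_le_mul (indep_apply_le_mul fun g x => ?_) _ _
  split_ifs
  · exact noisyBit_le_mul hb _ _ _ h x
  · refine le_mul_of_one_le_left zero_le ?_
    rw [ENNReal.one_le_ofReal]
    exact Real.one_le_exp hb.le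

theorem parallelProtocol_sample_le {n : ℕ} {ψ ε B : ℝ}
    (hb : 0 < ε / (8 * (logCeil ψ n : ℝ) ^ 2)) {π : Transcript n} {q : Query n}
    (hq : parallelProtocol n ψ ε π = some q) (G : SimpleGraph (Fin n)) :
    (q.sample G).toOuterMeasure {o | ∃ i, ∃ g : Fin (2 * logCeil ψ n),
      ¬ FaithfulMove G (fun m => ∃ s : Message, m = some s ∧ s[(g : ℕ)]? = some true)
        ((1 + ψ) ^ (g : ℕ)) B π i (∃ s : Message, o i = some s ∧ s[(g : ℕ)]? = some true)} ≤
        n * ((2 * logCeil ψ n : ℕ) *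
          ENNReal.ofReal (2 * Real.exp (-(ε / (8 * (logCeil ψ n : ℝ) ^ 2) / 2 * B)))) := by
  unfold parallelProtocol at hq
  simp only [Option.ite_none_right_eq_some, Option.some.injEq] at hq
  obtain ⟨_, rfl⟩ := hq
  refine (indep_exists_le n _ fun i => {m | ∃ g : Fin (2 * logCeil ψ n),
      ¬ FaithfulMove G (fun m => ∃ s : Message, m = some s ∧ s[(g : ℕ)]? = some true)
        ((1 + ψ) ^ (g : ℕ)) B π i (∃ s : Message, m = some s ∧ s[(g : ℕ)]? = some true)}).trans ?_
  refine (Finset.sum_le_card_nsmul _ _ _ fun i _ => ?_).trans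
    (by rw [Finset.card_univ, Fintype.card_fin, nsmul_eq_mul])
  rw [if_pos (Finset.mem_univ i), PMF.toOuterMeasure_map_apply, PMF.toOuterMeasure_map_apply]
  -- Entry `g` of the message is coordinate `g` of the sample, so a second union bound over the
  -- groups applies.
  have hset : List.ofFn ⁻¹' (some ⁻¹' {m | ∃ g : Fin (2 * logCeil ψ n),
      ¬ FaithfulMove G (fun m => ∃ s : Message, m = some s ∧ s[(g : ℕ)]? = some true)
        ((1 + ψ) ^ (g : ℕ)) B π i (∃ s : Message, m = some s ∧ s[(g : ℕ)]? = some true)}) =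
      {f | ∃ g : Fin (2 * logCeil ψ n), f g ∈ {x : Bool | ¬ FaithfulMove G
        (fun m => ∃ s : Message, m = some s ∧ s[(g : ℕ)]? = some true)
        ((1 + ψ) ^ (g : ℕ)) B π i (x = true)}} := by
    ext f
    simp
  rw [hset]
  refine (indep_exists_le _ _ _).trans ?_
  refine (Finset.sum_le_card_nsmul _ _ _ fun g _ => ?_).trans
    (by rw [Finset.card_univ, Fintype.card_fin, nsmul_eq_mul])
  simp only [groupLevel_eq_moveCount]
  split_ifs with hi
  · exact noisyBit_not_faithfulMove_le hb hi
  · exact pure_not_faithfulMove_le (moved := (· = true)) hi (by simp) _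

/-! ### Message sizes -/

theorem mem_support_of_mem_support_indep {α : Type*} {m : ℕ} {p : Fin m → PMF α} {f : Fin m → α}
    (hf : f ∈ (indep m p).support) (i : Fin m) : f i ∈ (p i).support := by
  rw [PMF.mem_support_iff, indep_apply, Finset.prod_ne_zero_iff] at hf
  exact hf i (Finset.mem_univ i)

theorem Protocol.messageBitsAtMost_of_support {n : ℕ} {P : Protocol n} {b : ℝ}
    (h : ∀ π q, P π = some q → ∀ i a, ∀ m ∈ (q.randomizer i a).support, (m.length : ℝ) ≤ b) :
    P.MessageBitsAtMost b := by
  intro G t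
  induction t with
  | zero =>
    intro π hπ ρ hρ
    rw [Protocol.run, PMF.mem_support_pure_iff] at hπ
    simp [hπ] at hρ
  | succ t ih =>
    intro π' hπ' ρ hρ i m hm
    rw [Protocol.run, PMF.mem_support_bind_iff] at hπ'
    obtain ⟨π, hπ, hπ'⟩ := hπ'
    unfold Protocol.step at hπ'
    cases hq : P π with
    | none =>
      rw [hq] at hπ'
      simp only [PMF.mem_support_pure_iff] at hπ'
      exact ih π hπ ρ (hπ' ▸ hρ) i m hm
    | some q =>
      rw [hq] at hπ'
      simp only [PMF.mem_support_map_iff] at hπ'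
      obtain ⟨o, ho, rfl⟩ := hπ'
      rw [List.mem_append, List.mem_singleton] at hρ
      rcases hρ with hρ | rfl
      · exact ih π hπ ρ hρ i m hm
      · have hoi := mem_support_of_mem_support_indep ho i
        simp only at hm
        rw [hm] at hoi
        split_ifs at hoi
        · rw [PMF.mem_support_map_iff] at hoi
          obtain ⟨m', hm', heq⟩ := hoi
          rw [← Option.some.inj heq]
          exact h π q hq i _ m' hm'
        · simp at hoi

theorem sequentialProtocol_messageBitsAtMost (n : ℕ) (ψ ε : ℝ) :
    (sequentialProtocol n ψ ε).MessageBitsAtMost 1 := by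
  refine Protocol.messageBitsAtMost_of_support fun π q hq i a m hm => ?_
  unfold sequentialProtocol at hq
  simp only [Option.ite_none_right_eq_some, Option.some.injEq] at hq
  obtain ⟨_, rfl⟩ := hq
  rw [PMF.mem_support_map_iff] at hm
  obtain ⟨x, _, rfl⟩ := hm
  simp

theorem parallelProtocol_messageBitsAtMost {n : ℕ} {ψ : ℝ} (ε : ℝ) {b : ℝ}
    (hb : 2 * (logCeil ψ n : ℝ) ≤ b) : (parallelProtocol n ψ ε).MessageBitsAtMost b := by
  refine Protocol.messageBitsAtMost_of_support fun π q hq i a m hm => ?_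
  unfold parallelProtocol at hq
  simp only [Option.ite_none_right_eq_some, Option.some.injEq] at hq
  obtain ⟨_, rfl⟩ := hq
  rw [PMF.mem_support_map_iff] at hm
  obtain ⟨x, _, rfl⟩ := hm
  rw [List.length_ofFn]
  push_cast
  exact hb

/-! ### The number of levels -/

theorem one_le_logCeil {n : ℕ} {ψ : ℝ} (hψ : 0 < ψ) (hn : 2 ≤ n) : 1 ≤ logCeil ψ n :=
  Nat.ceil_pos.2 (Real.logb_pos (by linarith) (by exact_mod_cast hn))

theorem le_pow_of_logCeil_le {n : ℕ} {ψ : ℝ} (hψ : 0 < ψ) (hn : 2 ≤ n) {m : ℕ}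
    (hm : logCeil ψ n ≤ m) : (n : ℝ) ≤ (1 + ψ) ^ m := by
  rw [← Real.rpow_natCast, ← Real.logb_le_iff_le_rpow (by linarith)
    (by exact_mod_cast Nat.zero_lt_of_lt hn)]
  exact (Nat.le_ceil _).trans (by exact_mod_cast hm)

theorem logCeil_le {n : ℕ} {ψ : ℝ} (hψ : 0 < ψ) (hn : 2 ≤ n) :
    (logCeil ψ n : ℝ) ≤ (1 / Real.log (1 + ψ) + 1 / Real.log 2) * Real.log n := by
  have hn' : (2 : ℝ) ≤ n := by exact_mod_cast hn
  have h1 := Nat.ceil_lt_add_one (Real.logb_nonneg (b := 1 + ψ) (x := n) (by linarith)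
    (by linarith))
  -- The summand `1 / log 2` absorbs the rounding up.
  have h2 : 1 ≤ 1 / Real.log 2 * Real.log n := by
    rw [one_div_mul_eq_div, le_div_iff₀ (Real.log_pos one_lt_two), one_mul]
    exact Real.log_le_log two_pos hn'
  have h3 : Real.logb (1 + ψ) n = 1 / Real.log (1 + ψ) * Real.log n := by
    rw [Real.logb, one_div_mul_eq_div]
  rw [add_mul, ← h3]
  exact h1.le.trans (by linarith)

theorem coreNumber_le {n : ℕ} (G : SimpleGraph (Fin n)) (v : Fin n) : coreNumber G v ≤ n :=
  Nat.findGreatest_le n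

/-! ### Estimates read off a transcript of faithful moves -/

/-- The choice `lam = ψ - 1` makes the estimate `(1 + ψ) ^ (g + 1)`, the threshold of the first
group not completed. The lower bound then loses only `B`, and the upper bound one more factor `1 +
ψ`. For `g = 0` the estimate is at most `2`, hence at most `2 * B`. -/
theorem isApproxCoreNumber_of_group {ψ B : ℝ} (hψ : 0 < ψ) (hψ1 : ψ ≤ 1) (hB : 1 ≤ B) {k g : ℕ}
    (hlow : (k : ℝ) ≤ (1 + ψ) ^ (g + 1) + B)
    (hup : g = 0 ∨ (1 + ψ) ^ g - B < 2 * (1 + ψ) * k) :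
    IsApproxCoreNumber (2 * (1 + ψ) ^ 2) (2 * B) k ((2 + (ψ - 1)) * (1 + ψ) ^ g) := by
  have he : (2 + (ψ - 1)) * (1 + ψ) ^ g = (1 + ψ) ^ (g + 1) := by ring
  rw [he]
  refine ⟨by linarith, ?_⟩
  rcases hup with rfl | hup
  · have : 0 ≤ 2 * (1 + ψ) ^ 2 * (k : ℝ) := by positivity
    linarith
  · have h1 : (1 + ψ) * (1 + ψ) ^ g ≤ (1 + ψ) * (2 * (1 + ψ) * k + B) :=
      mul_le_mul_of_nonneg_left (by linarith) (by linarith)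
    have h2 : (1 + ψ) * B ≤ 2 * B := mul_le_mul_of_nonneg_right (by linarith) (by linarith)
    calc (1 + ψ) ^ (g + 1) = (1 + ψ) * (1 + ψ) ^ g := pow_succ' _ _
      _ ≤ 2 * (1 + ψ) ^ 2 * k + (1 + ψ) * B := by linarith
      _ ≤ _ := by linarith

theorem parallelAlgorithm_isApproxCoreNumber {n : ℕ} {ψ ε B : ℝ} (hψ : 0 < ψ) (hψ1 : ψ ≤ 1)
    (hB : 1 ≤ B) (hn : 2 ≤ n) {G : SimpleGraph (Fin n)} {π : Transcript n}
    (hlen : π.length = 2 * logCeil ψ n - 1)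
    (h : ∀ g < 2 * logCeil ψ n, ∀ k (hk : k < π.length), ∀ i,
      FaithfulMove G (fun m => ∃ s : Message, m = some s ∧ s[g]? = some true) ((1 + ψ) ^ g) B
        (π.take k) i (∃ s : Message, π[k].output i = some s ∧ s[g]? = some true)) (i : Fin n) :
    IsApproxCoreNumber (2 * (1 + ψ) ^ 2) (2 * B) (coreNumber G i)
      ((parallelAlgorithm n ψ (ψ - 1) ε).estimate π i) := by
  classical
  have hl := one_le_logCeil hψ hn
  have hpeel := fun g hg => isPeeling_movers (τ := fun _ => (1 + ψ) ^ g) (h g hg)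
  have hmem : ∀ g, groupLevel π g i = 2 * logCeil ψ n - 1 ↔ i ∈ movers
      (fun m => ∃ s : Message, m = some s ∧ s[g]? = some true) (π.take π.length) := by
    intro g
    rw [List.take_length, mem_movers, hlen, groupLevel_eq_moveCount]
  have hest : (parallelAlgorithm n ψ (ψ - 1) ε).estimate π i = (2 + (ψ - 1)) * (1 + ψ) ^
      Nat.findGreatest (fun g => g < 2 * logCeil ψ n ∧ groupLevel π g i = 2 * logCeil ψ n - 1)
        (2 * logCeil ψ n) := by
    simp only [parallelAlgorithm]
  rw [hest]
  generalize hg : Nat.findGreatest (fun g => g < 2 * logCeil ψ n ∧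
    groupLevel π g i = 2 * logCeil ψ n - 1) (2 * logCeil ψ n) = g
  rw [Nat.findGreatest_eq_iff] at hg
  obtain ⟨hgle, hgspec, hgmax⟩ := hg
  refine isApproxCoreNumber_of_group hψ hψ1 hB ?_ ?_
  · rcases lt_or_ge (g + 1) (2 * logCeil ψ n) with hlt | hge
    · by_contra! hcon
      refine hgmax (Nat.lt_succ_self g) hlt.le ⟨hlt, (hmem _).2 ?_⟩
      exact (hpeel (g + 1) hlt).mem_of_coreNumber i le_rfl fun _ _ => hcon
    -- No group lies above `g`, but the next power already exceeds every core number.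
    · have h1 : (coreNumber G i : ℝ) ≤ n := by exact_mod_cast coreNumber_le G i
      have h2 := le_pow_of_logCeil_le hψ hn (m := g + 1) (by omega)
      linarith
  -- The value `0` may also be the default, which says nothing about the top level of group `0`.
  · rcases Nat.eq_zero_or_pos g with h0 | hpos
    · exact Or.inl h0
    · obtain ⟨hlt, hlev⟩ := hgspec hpos.ne'
      have hm := (hmem g).1 hlev
      -- All `2ℓ - 1` rounds of group `g` are used; `ℓ` of them would do.
      have hlen' : 0 + ((2 * logCeil ψ n - 2) + 1) = π.length := by omega
      rw [← hlen'] at hm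
      exact Or.inr ((hpeel g hlt).lt_coreNumber_of_mem i hlen'.le (by linarith)
        (le_pow_of_logCeil_le hψ hn (by omega)) (fun _ _ => le_rfl) hm)

theorem sequentialAlgorithm_isApproxCoreNumber {n : ℕ} {ψ ε B : ℝ} (hψ : 0 < ψ) (hψ1 : ψ ≤ 1)
    (hB : 1 ≤ B) (hn : 2 ≤ n) {G : SimpleGraph (Fin n)} {π : Transcript n}
    (hlen : π.length = 4 * logCeil ψ n ^ 2 - 1)
    (h : ∀ k (hk : k < π.length), ∀ i,
      FaithfulMove G (· = some [true]) ((1 + ψ) ^ (k / (2 * logCeil ψ n))) B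
        (π.take k) i (π[k].output i = some [true])) (i : Fin n) :
    IsApproxCoreNumber (2 * (1 + ψ) ^ 2) (2 * B) (coreNumber G i)
      ((sequentialAlgorithm n ψ (ψ - 1) ε).estimate π i) := by
  have hl := one_le_logCeil hψ hn
  have hpeel := isPeeling_movers (D := (· = some [true]))
    (τ := fun k => (1 + ψ) ^ (k / (2 * logCeil ψ n))) h
  have hmem := fun r (hr : r ≤ π.length) => mem_movers_iff_le_moveCount (D := (· = some [true]))
    (τ := fun k => (1 + ψ) ^ (k / (2 * logCeil ψ n))) h (i := i) hr
  have hLle := moveCount_le_length (· = some [true]) π i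
  change IsApproxCoreNumber _ _ _
    ((2 + (ψ - 1)) * (1 + ψ) ^ ((level π i + 1) / (2 * logCeil ψ n) - 1))
  rw [level_eq_moveCount]
  set L := moveCount (· = some [true]) π i
  set l := logCeil ψ n
  have hsq : 4 * l ^ 2 = 2 * l * (2 * l) := by ring
  have hsq1 : 1 ≤ 2 * l * (2 * l) := Nat.mul_pos (by omega) (by omega)
  have hdiv := Nat.div_add_mod (L + 1) (2 * l)
  have hmod := Nat.mod_lt (L + 1) (show 0 < 2 * l by omega)
  refine isApproxCoreNumber_of_group hψ hψ1 hB ?_ ?_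
  · set q := (L + 1) / (2 * l)
    by_contra! hcon
    have hlt : q - 1 + 1 < 2 * l := by
      by_contra! hge
      have h1 : (coreNumber G i : ℝ) ≤ n := by exact_mod_cast coreNumber_le G i
      have h2 := le_pow_of_logCeil_le hψ hn (m := q - 1 + 1) (by omega)
      linarith
    -- The top level of the group after `q - 1` has not been reached. The subtraction truncates, so
    -- `q = 0` and `q = 1` both give group `0`.
    have hL : L + 1 < 2 * l * (q - 1 + 2) := by
      have : 2 * l * (q + 1) ≤ 2 * l * (q - 1 + 2) := Nat.mul_le_mul_left _ (by omega)
      rw [mul_add, mul_one] at this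
      omega
    have hL' : 2 * l * (q - 1 + 2) ≤ 2 * l * (2 * l) := Nat.mul_le_mul_left _ (by omega)
    have hle : L + 1 ≤ π.length := by omega
    -- All thresholds through round `L` are at most that of the next group, so a larger core number
    -- would carry `i` to level `L + 1`.
    have := (hmem (L + 1) hle).1 (hpeel.mem_of_coreNumber i hle fun s hs => ?_)
    · omega
    · refine lt_of_le_of_lt ?_ hcon
      have hs' : s / (2 * l) ≤ q - 1 + 1 := by
        rw [← Nat.lt_succ_iff, Nat.div_lt_iff_lt_mul (by omega), mul_comm]
        exact lt_of_lt_of_le (by omega) hL.le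
      have := pow_le_pow_right₀ (show 1 ≤ 1 + ψ by linarith) hs'
      linarith
  · rcases Nat.eq_zero_or_pos ((L + 1) / (2 * l)) with h0 | hpos
    · exact Or.inl (by omega)
    · obtain ⟨g, hg⟩ := Nat.exists_eq_succ_of_ne_zero hpos.ne'
      rw [hg] at hdiv ⊢
      rw [Nat.succ_eq_add_one, Nat.add_sub_cancel]
      rw [Nat.succ_eq_add_one, mul_add, mul_one] at hdiv
      -- Group `g` ends at level `2ℓ(g + 1) - 1`, so a node there has survived the `2ℓ - 1` rounds
      -- starting with round `2ℓg`.
      refine Or.inr (hpeel.lt_coreNumber_of_mem i (r := 2 * l * g) (m := 2 * l - 2) (by omega)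
        (by linarith) (le_pow_of_logCeil_le hψ hn (by omega)) (fun j _ => ?_)
        ((hmem _ (by omega)).2 (by omega)))
      refine pow_le_pow_right₀ (by linarith) ?_
      rw [Nat.le_div_iff_mul_le (by omega), mul_comm]
      exact Nat.le_add_right _ _

/-! ### Approximation with high probability -/

theorem natCast_mul_ofReal_le {N : ℕ} {x y : ℝ} (h : N * x ≤ y) :
    (N : ENNReal) * ENNReal.ofReal x ≤ ENNReal.ofReal y := by
  rw [← ENNReal.ofReal_natCast, ← ENNReal.ofReal_mul (Nat.cast_nonneg N)]
  exact ENNReal.ofReal_le_ofReal h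

/-- The left side of `hδ` is the union bound: at most `4ℓ²n` noises, times the tail bound for one of
them. -/
theorem parallelAlgorithm_approximates {n : ℕ} {ψ ε B δ : ℝ} (hψ : 0 < ψ) (hψ1 : ψ ≤ 1)
    (hn : 2 ≤ n) (hε : 0 < ε) (hB : 1 ≤ B)
    (hδ : 4 * (logCeil ψ n : ℝ) ^ 2 * n *
      (2 * Real.exp (-(ε / (8 * (logCeil ψ n : ℝ) ^ 2) / 2 * B))) ≤ δ) :
    (parallelAlgorithm n ψ (ψ - 1) ε).Approximates (2 * logCeil ψ n - 1)
      (2 * (1 + ψ) ^ 2) (2 * B) (1 - δ) := by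
  have hl : (1 : ℝ) ≤ logCeil ψ n := by exact_mod_cast one_le_logCeil hψ hn
  have hb : 0 < ε / (8 * (logCeil ψ n : ℝ) ^ 2) := by positivity
  have hnone := parallelProtocol_eq_none_iff n ψ ε
  refine ⟨Protocol.haltsWithin_of_length hnone, fun G => ?_⟩
  refine one_sub_le_toOuterMeasure _ (le_trans (by positivity) hδ)
    ((Protocol.run_exists_bad_le (fun π q hq => parallelProtocol_sample_le (B := B) hb hq G)
      _).trans ?_) fun π hπ hgood i => ?_
  · rw [← mul_assoc, ← mul_assoc, ← Nat.cast_mul, ← Nat.cast_mul]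
    refine natCast_mul_ofReal_le (le_trans ?_ hδ)
    refine mul_le_mul_of_nonneg_right ?_ (by positivity)
    have h1 : (2 * logCeil ψ n - 1) * n * (2 * logCeil ψ n) ≤ 4 * logCeil ψ n ^ 2 * n := by
      calc _ ≤ (2 * logCeil ψ n) * n * (2 * logCeil ψ n) := by gcongr; omega
        _ = _ := by ring
    exact_mod_cast h1
  · have hlen := Protocol.length_of_mem_support hnone G _ π hπ
    rw [min_self] at hlen
    refine parallelAlgorithm_isApproxCoreNumber hψ hψ1 hB hn hlen (fun g hg k hk j => ?_) i
    by_contra hbad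
    refine hgood ⟨k, hk, j, ⟨g, hg⟩, ?_⟩
    exact hbad

theorem sequentialAlgorithm_approximates {n : ℕ} {ψ ε B δ : ℝ} (hψ : 0 < ψ) (hψ1 : ψ ≤ 1)
    (hn : 2 ≤ n) (hε : 0 < ε) (hB : 1 ≤ B)
    (hδ : 4 * (logCeil ψ n : ℝ) ^ 2 * n *
      (2 * Real.exp (-(ε / (8 * (logCeil ψ n : ℝ) ^ 2) / 2 * B))) ≤ δ) :
    (sequentialAlgorithm n ψ (ψ - 1) ε).Approximates (4 * logCeil ψ n ^ 2 - 1)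
      (2 * (1 + ψ) ^ 2) (2 * B) (1 - δ) := by
  have hl : (1 : ℝ) ≤ logCeil ψ n := by exact_mod_cast one_le_logCeil hψ hn
  have hb : 0 < ε / (8 * (logCeil ψ n : ℝ) ^ 2) := by positivity
  have hnone := sequentialProtocol_eq_none_iff n ψ ε
  refine ⟨Protocol.haltsWithin_of_length hnone, fun G => ?_⟩
  refine one_sub_le_toOuterMeasure _ (le_trans (by positivity) hδ)
    ((Protocol.run_exists_bad_le (fun π q hq => sequentialProtocol_sample_le (B := B) hb hq G)
      _).trans ?_) fun π hπ hgood i => ?_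
  · rw [← mul_assoc, ← Nat.cast_mul]
    refine natCast_mul_ofReal_le (le_trans ?_ hδ)
    refine mul_le_mul_of_nonneg_right ?_ (by positivity)
    have h1 : (4 * logCeil ψ n ^ 2 - 1) * n ≤ 4 * logCeil ψ n ^ 2 * n := by
      gcongr
      omega
    exact_mod_cast h1
  · have hlen := Protocol.length_of_mem_support hnone G _ π hπ
    rw [min_self] at hlen
    refine sequentialAlgorithm_isApproxCoreNumber hψ hψ1 hB hn hlen (fun k hk j => ?_) i
    by_contra hbad
    refine hgood ⟨k, hk, j, ?_⟩
    rw [List.length_take, min_eq_left hk.le]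
    exact hbad

theorem CoreAlgorithm.Approximates.mono {n : ℕ} {A : CoreAlgorithm n} {T : ℕ}
    {φ ζ φ' ζ' p : ℝ} (h : A.Approximates T φ ζ p) (hφ : φ ≤ φ') (hζ : ζ ≤ ζ') :
    A.Approximates T φ' ζ' p := by
  refine ⟨h.1, fun G => (h.2 G).trans (PMF.toOuterMeasure_mono _ ?_)⟩
  rintro π ⟨hπ, _⟩ i
  obtain ⟨h1, h2⟩ := hπ i
  have := mul_le_mul_of_nonneg_right hφ (Nat.cast_nonneg (α := ℝ) (coreNumber G i))
  exact ⟨by linarith, by linarith⟩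

/-! ### Privacy of the two protocols -/

/-- The budget: fewer than `2ℓ` rounds, two ends of the edge, and `2ℓ` bits of cost `b` each, with
`8ℓ²b = ε`. -/
theorem parallelProtocol_isLEDP {n : ℕ} {ψ ε : ℝ} (hψ : 0 < ψ) (hn : 2 ≤ n) (hε : 0 < ε) :
    (parallelProtocol n ψ ε).IsLEDP ε := by
  have hl1 := one_le_logCeil hψ hn
  have hl : (1 : ℝ) ≤ logCeil ψ n := by exact_mod_cast hl1
  have hb : 0 < ε / (8 * (logCeil ψ n : ℝ) ^ 2) := by positivity
  refine ⟨fun π q hq i _ => ?_, ?_⟩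
  · obtain ⟨h1, h2⟩ := parallelProtocol_isLocalRandomizer hb hq i
    rwa [h1]
  · refine Protocol.edgeDP_run (parallelProtocol_eq_none_iff n ψ ε) (by positivity)
      (fun π q hq i _ => (parallelProtocol_isLocalRandomizer hb hq i).2) ?_
    have h1 : ((2 * logCeil ψ n - 1 : ℕ) : ℝ) ≤ 2 * logCeil ψ n := by
      exact_mod_cast Nat.sub_le _ _
    calc _ ≤ (2 * (logCeil ψ n : ℝ)) *
          (2 * (2 * logCeil ψ n * (ε / (8 * (logCeil ψ n : ℝ) ^ 2)))) :=
          mul_le_mul_of_nonneg_right h1 (by positivity)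
      _ = ε := by field_simp; ring

theorem sequentialProtocol_isLEDP {n : ℕ} {ψ ε : ℝ} (hψ : 0 < ψ) (hn : 2 ≤ n) (hε : 0 < ε) :
    (sequentialProtocol n ψ ε).IsLEDP ε := by
  have hl1 := one_le_logCeil hψ hn
  have hl : (1 : ℝ) ≤ logCeil ψ n := by exact_mod_cast hl1
  have hb : 0 < ε / (8 * (logCeil ψ n : ℝ) ^ 2) := by positivity
  refine ⟨fun π q hq i _ => ?_, ?_⟩
  · obtain ⟨h1, h2⟩ := sequentialProtocol_isLocalRandomizer hb hq i
    rwa [h1]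
  · refine Protocol.edgeDP_run (sequentialProtocol_eq_none_iff n ψ ε) hb.le
      (fun π q hq i _ => (sequentialProtocol_isLocalRandomizer hb hq i).2) ?_
    have h1 : ((4 * logCeil ψ n ^ 2 - 1 : ℕ) : ℝ) ≤ 4 * (logCeil ψ n : ℝ) ^ 2 := by
      exact_mod_cast Nat.sub_le _ _
    calc _ ≤ (4 * (logCeil ψ n : ℝ) ^ 2) * (2 * (ε / (8 * (logCeil ψ n : ℝ) ^ 2))) :=
          mul_le_mul_of_nonneg_right h1 (by positivity)
      _ = ε := by field_simp; ring

/-- The failure probability is polynomially small for an error of order `log³ n / ε`. -/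
theorem failure_probability_le {n l : ℕ} {A c ε B : ℝ} (hn : 2 ≤ n) (hl : 1 ≤ l)
    (hlA : (l : ℝ) ≤ A * Real.log n) (hA : 0 < A) (hc : 0 ≤ c) (hε : 0 < ε)
    (hB : B = 16 * A ^ 2 * (4 + 2 * A + c) * Real.log n ^ 3 / ε) :
    4 * (l : ℝ) ^ 2 * n * (2 * Real.exp (-(ε / (8 * (l : ℝ) ^ 2) / 2 * B))) ≤ 1 / (n : ℝ) ^ c := by
  have hn' : (2 : ℝ) ≤ n := by exact_mod_cast hn
  have hnpos : (0 : ℝ) < n := by linarith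
  have hl' : (1 : ℝ) ≤ l := by exact_mod_cast hl
  have hlog : 0 < Real.log n := Real.log_pos (by linarith)
  have hexpo : (4 + 2 * A + c) * Real.log n ≤ ε / (8 * (l : ℝ) ^ 2) / 2 * B := by
    have h1 : ε / (8 * (l : ℝ) ^ 2) / 2 * B =
        ((4 + 2 * A + c) * Real.log n) * ((A * Real.log n) ^ 2 / (l : ℝ) ^ 2) := by
      rw [hB]
      field_simp
      ring
    rw [h1]
    refine le_mul_of_one_le_right (by positivity) ?_
    rw [one_le_div (by positivity)]
    exact pow_le_pow_left₀ (by linarith) hlA 2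
  -- Crudely `ℓ ≤ n ^ A`, so all factors become powers of `n`. The exponent `4 + 2A + c` pays `3`
  -- for the constant `8`, `1` for `n`, `2A` for `ℓ²`, and leaves `c`.
  have hlexp : (l : ℝ) ≤ Real.exp (A * Real.log n) :=
    hlA.trans ((by linarith [Real.add_one_le_exp (A * Real.log n)]))
  have hnexp : (n : ℝ) = Real.exp (Real.log n) := (Real.exp_log hnpos).symm
  have h8 : (8 : ℝ) ≤ Real.exp (Real.log n) ^ 3 := by
    rw [← hnexp]
    calc (8 : ℝ) = 2 ^ 3 := by norm_num
      _ ≤ _ := pow_le_pow_left₀ zero_le_two hn' 3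
  calc 4 * (l : ℝ) ^ 2 * n * (2 * Real.exp (-(ε / (8 * (l : ℝ) ^ 2) / 2 * B)))
      = 8 * (l : ℝ) ^ 2 * n * Real.exp (-(ε / (8 * (l : ℝ) ^ 2) / 2 * B)) := by ring
    _ ≤ Real.exp (Real.log n) ^ 3 * Real.exp (A * Real.log n) ^ 2 * Real.exp (Real.log n) *
        Real.exp (-((4 + 2 * A + c) * Real.log n)) := by
        rw [← hnexp] at h8 ⊢
        gcongr
    _ = 1 / (n : ℝ) ^ c := by
        rw [Real.rpow_def_of_pos hnpos, one_div, ← Real.exp_neg, ← Real.exp_nat_mul,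
          ← Real.exp_nat_mul, ← Real.exp_add, ← Real.exp_add, ← Real.exp_add]
        congr 1
        push_cast
        ring

end LEDP

/-- For every `η > 0` there are parameters `ψ`, `lam`, depending on `η` only, such that the one-bit
level protocol with `O(log² n)` rounds and the `O(log n)`-bit level protocol with `O(log n)` rounds
are `ε`-LEDP and both return `(2 + η, O(log³ n / ε))`-approximate core numbers with probability at
least `1 - 1 / n ^ c`, for every constant `c ≥ 1`. -/
theorem mainTheorem1 (η : ℝ) (hη : 0 < η) :
    ∃ ψ lam : ℝ, 0 < ψ ∧ ψ < 1 ∧ -1 < lam ∧ lam < 1 ∧ ∃ K : ℝ, 0 < K ∧ ∃ C : ℝ → ℝ, (∀ c, 0 < C c) ∧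
      ∀ n : ℕ, 2 ≤ n → ∀ ε : ℝ, 0 < ε → ε < 1 →
        ((LEDP.parallelAlgorithm n ψ lam ε).protocol.IsLEDP ε ∧
          (LEDP.parallelAlgorithm n ψ lam ε).protocol.MessageBitsAtMost (K * Real.log n) ∧
          ∃ T : ℕ, (T : ℝ) ≤ K * Real.log n ∧ ∀ c : ℝ, 1 ≤ c →
            (LEDP.parallelAlgorithm n ψ lam ε).Approximates T
              (2 + η) (C c * Real.log n ^ 3 / ε) (1 - 1 / (n : ℝ) ^ c)) ∧
        ((LEDP.sequentialAlgorithm n ψ lam ε).protocol.IsLEDP ε ∧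
          (LEDP.sequentialAlgorithm n ψ lam ε).protocol.MessageBitsAtMost 1 ∧
          ∃ T : ℕ, (T : ℝ) ≤ K * Real.log n ^ 2 ∧ ∀ c : ℝ, 1 ≤ c →
            (LEDP.sequentialAlgorithm n ψ lam ε).Approximates T
              (2 + η) (C c * Real.log n ^ 3 / ε) (1 - 1 / (n : ℝ) ^ c)) := by
  obtain ⟨ψ, hψ, hψ2, hψη⟩ : ∃ ψ : ℝ, 0 < ψ ∧ ψ ≤ 1 / 2 ∧ ψ ≤ η / 6 :=
    -- With `ψ ≤ 1 / 2` one has `2(1 + ψ)² - 2 = 4ψ + 2ψ² ≤ 5ψ`, which is below `η`.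
    ⟨min (1 / 2) (η / 6), by positivity, min_le_left _ _, min_le_right _ _⟩
  have hlog1 : 0 < Real.log (1 + ψ) := Real.log_pos (by linarith)
  have hlog2 : 0 < Real.log 2 := Real.log_pos one_lt_two
  obtain ⟨A, hAdef⟩ : ∃ A : ℝ, A = 1 / Real.log (1 + ψ) + 1 / Real.log 2 := ⟨_, rfl⟩
  have hA : 0 < A := by rw [hAdef]; positivity
  -- The two terms of `K` cover `2ℓ` and `4ℓ²` respectively. The absolute value keeps `C c` positive
  -- for every real `c`.
  refine ⟨ψ, ψ - 1, hψ, by linarith, by linarith, by linarith, 2 * A + 4 * A ^ 2, by positivity,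
    fun c => 2 * (16 * A ^ 2 * (4 + 2 * A + |c|)), fun c => by positivity,
    fun n hn ε hε hε1 => ?_⟩
  have hlA := LEDP.logCeil_le hψ hn
  rw [← hAdef] at hlA
  have hl := LEDP.one_le_logCeil hψ hn
  have hlR : (1 : ℝ) ≤ LEDP.logCeil ψ n := by exact_mod_cast hl
  have hlogn : 1 / 2 ≤ Real.log n := by
    have h1 : Real.log 2 ≤ Real.log n := Real.log_le_log two_pos (by exact_mod_cast hn)
    linarith [Real.log_two_gt_d9]
  have hφ : 2 * (1 + ψ) ^ 2 ≤ 2 + η := by nlinarith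
  -- The error must be at least `1` to absorb the estimate of group `0`; this follows from `1 ≤ ℓ ≤
  -- A log n` and `ε < 1`.
  have hB : ∀ c : ℝ, 1 ≤ 16 * A ^ 2 * (4 + 2 * A + |c|) * Real.log n ^ 3 / ε := by
    intro c
    rw [one_le_div hε]
    have h1 : 1 ≤ (A * Real.log n) ^ 2 := one_le_pow₀ (hlR.trans hlA)
    have h2 : 4 * (1 / 2) ≤ (4 + 2 * A + |c|) * Real.log n :=
      mul_le_mul (by linarith [abs_nonneg c]) hlogn (by norm_num) (by positivity)
    nlinarith [mul_le_mul h1 h2 (by norm_num) (by positivity)]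
  have hζ : ∀ c : ℝ, 2 * (16 * A ^ 2 * (4 + 2 * A + |c|) * Real.log n ^ 3 / ε) =
      2 * (16 * A ^ 2 * (4 + 2 * A + |c|)) * Real.log n ^ 3 / ε := fun c => by ring
  have hδ := fun (c : ℝ) (hc : 1 ≤ c) => LEDP.failure_probability_le
    (B := 16 * A ^ 2 * (4 + 2 * A + |c|) * Real.log n ^ 3 / ε) hn hl hlA hA (zero_le_one.trans hc)
    hε (by rw [abs_of_nonneg (zero_le_one.trans hc)])
  have hK1 : 2 * (LEDP.logCeil ψ n : ℝ) ≤ (2 * A + 4 * A ^ 2) * Real.log n := by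
    nlinarith [mul_nonneg (sq_nonneg A) (show 0 ≤ Real.log n by linarith)]
  have hK2 : 4 * (LEDP.logCeil ψ n : ℝ) ^ 2 ≤ (2 * A + 4 * A ^ 2) * Real.log n ^ 2 := by
    have := pow_le_pow_left₀ (by linarith) hlA 2
    nlinarith [mul_nonneg hA.le (sq_nonneg (Real.log n))]
  refine ⟨⟨LEDP.parallelProtocol_isLEDP hψ hn hε,
    LEDP.parallelProtocol_messageBitsAtMost ε hK1, 2 * LEDP.logCeil ψ n - 1, ?_, fun c hc => ?_⟩,
    ⟨LEDP.sequentialProtocol_isLEDP hψ hn hε, LEDP.sequentialProtocol_messageBitsAtMost n ψ ε,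
      4 * LEDP.logCeil ψ n ^ 2 - 1, ?_, fun c hc => ?_⟩⟩
  · refine le_trans ?_ hK1
    exact_mod_cast Nat.sub_le _ _
  · exact (LEDP.parallelAlgorithm_approximates hψ (by linarith) hn hε (hB c) (hδ c hc)).mono hφ
      (hζ c).le
  · refine le_trans ?_ hK2
    exact_mod_cast Nat.sub_le _ _
  · exact (LEDP.sequentialAlgorithm_approximates hψ (by linarith) hn hε (hB c) (hδ c hc)).mono hφ
      (hζ c).le
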